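/- Let $X$ be a smooth ($C^\infty$) finite-dimensional Riemannian manifold without boundary, with Levi-Civita connection $\nabla$, and let $\phi$ be a calibration of degree $p$ on $X$, i.e. a smooth closed $p$-form with $\phi(\xi)\le 1$ for every unit simple tangent $p$-vector $\xi$. Write $G(\phi)$ for the set of $\phi$-planes, i.e. unit simple $p$-vectors $\xi=e_1\wedge\dots\wedge e_p$ ($e_1,\dots,e_p$ orthonormal in some $T_xX$) with $\phi(\xi)=1$. For a smooth function $f$ let $\mathcal H^\phi(f)$ be its $\phi$-Hessian, the $p$-form $$\mathcal H^\phi(f)(v_1,\dots,v_p)=\sum_{i=1}^p \phi\big(v_1,\dots,(\operatorname{Hess} f)(v_i),\dots,v_p\big),\qquad (\operatorname{Hess} f)(v)=\nabla_v\nabla f .$$ A smooth function $f$ on an open set $W\subset X$ is called strictly $\phi$-plurisubharmonic on $W$ if $\mathcal H^\phi(f)(\xi)>0$ for every $\phi$-plane $\xi$ at every point of $W$. Let $\Omega\subset X$ be an open set with compact closure and smooth boundary: there is a defining function for $\partial\Omega$, i.e. a smooth function $\rho$ on a neighborhood of $\overline\Omega$ with $\Omega=\{\rho<0\}$ and $\nabla\rho\ne0$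 on $\partial\Omega$. The boundary $\partial\Omega$ is called $\phi$-convex if, for every defining function $\rho$ (equivalently, for one), $$\mathcal H^\phi(\rho)(\xi)\ge 0\quad\text{for all } x\in\partial\Omega \text{ and all } \phi\text{-planes } \xi \text{ at } x \text{ with } \operatorname{span}\xi\subset T_x\partial\Omega .$$ **Proposition 4.8.** Suppose $\phi$ is parallel ($\nabla\phi=0$), and let $\delta=\operatorname{dist}(\cdot,\partial\Omega)$ be the Riemannian distance to $\partial\Omega$. If $-\log\delta$ is strictly $\phi$-plurisubharmonic near $\partial\Omega$, i.e. on $U\cap\Omega$ for some open neighborhood $U$ of $\partial\Omega$ in $X$, then $\partial\Omega$ is $\phi$-convex. -/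

import Mathlib

set_option maxSynthPendingDepth 3

open Set Manifold Topology
open scoped ContDiff

namespace CalibratedGeometry

noncomputable section

/-- The action of an endomorphism `A` on an alternating `p`-form `α` as a derivation,
`(D_{Aᵗ} α)(v₁, …, v_p) = ∑ i, α(v₁, …, A vᵢ, …, v_p)`. -/
def derivationAction {V : Type*} [AddCommGroup V] [Module ℝ V] [TopologicalSpace V] {p : ℕ}
    (α : V [⋀^Fin p]→L[ℝ] ℝ) (A : V →L[ℝ] V) (v : Fin p → V) : ℝ :=
  ∑ i, α (Function.update v i (A (v i)))

section Christoffel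

variable {E : Type*} [NormedAddCommGroup E] [NormedSpace ℝ E]

/-- The Christoffel symbols of the first kind of a metric `g` on an open subset of `E`:
`(u, v, z) ↦ (∂_u g(v, z) + ∂_v g(u, z) - ∂_z g(u, v)) / 2`. -/
def christoffelLower (g : E → E →L[ℝ] E →L[ℝ] ℝ) (y : E) : E →L[ℝ] E →L[ℝ] E →L[ℝ] ℝ :=
  let T : E →L[ℝ] E →L[ℝ] E →L[ℝ] ℝ := fderiv ℝ g y
  let S : E →L[ℝ] E →L[ℝ] E →L[ℝ] ℝ :=
    (ContinuousLinearMap.flipₗᵢ ℝ E E ℝ : (E →L[ℝ] E →L[ℝ] ℝ) →L[ℝ] E →L[ℝ] E →L[ℝ] ℝ).comp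
      T.flip
  (2⁻¹ : ℝ) • (T + T.flip - S)

theorem christoffelLower_apply (g : E → E →L[ℝ] E →L[ℝ] ℝ) (y u v z : E) :
    christoffelLower g y u v z =
      2⁻¹ * (fderiv ℝ g y u v z + fderiv ℝ g y v u z - fderiv ℝ g y z u v) :=
  rfl

/-- The Christoffel symbols `Γ(u, v) = u^i v^j Γ^k_{ij} ∂_k` of the Levi-Civita connection of a
metric `g` on an open subset of `E`, obtained by raising the last index with the inverse of the
(positive definite, hence invertible) bilinear form `g y`. -/
def christoffelOf (g : E → E →L[ℝ] E →L[ℝ] ℝ) (y : E) : E →L[ℝ] E →L[ℝ] E :=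
  (ContinuousLinearMap.compL ℝ E (E →L[ℝ] ℝ) E (g y).inverse).comp (christoffelLower g y)

/-- The coordinate expression `∂_i ∂_j h - Γ^k_{ij} ∂_k h` of the Hessian of `h` with respect to a
metric `g` on an open subset of `E`. -/
def hessianOf (g : E → E →L[ℝ] E →L[ℝ] ℝ) (h : E → ℝ) (y : E) : E →L[ℝ] E →L[ℝ] ℝ :=
  fderiv ℝ (fderiv ℝ h) y
    - (ContinuousLinearMap.compL ℝ E E ℝ (fderiv ℝ h y)).comp (christoffelOf g y)

theorem hessianOf_apply (g : E → E →L[ℝ] E →L[ℝ] ℝ) (h : E → ℝ) (y u v : E) :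
    hessianOf g h y u v =
      fderiv ℝ (fderiv ℝ h) y u v - fderiv ℝ h y (christoffelOf g y u v) :=
  rfl

end Christoffel

end

end CalibratedGeometry

open Bundle

namespace CalibratedGeometry

noncomputable section

variable {E : Type*} [NormedAddCommGroup E] [NormedSpace ℝ E]
  {X : Type*} [EMetricSpace X] [ChartedSpace E X]

section Boundary

variable (E)

/-- `ρ` is a defining function for the boundary of `Ω`: it is smooth on a neighbourhood `N` of the
closure of `Ω`, where `Ω = {ρ < 0}`, and `dρ ≠ 0` (equivalently `∇ρ ≠ 0`) along the boundary. -/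
def IsDefiningFunction (ρ : X → ℝ) (Ω : Set X) : Prop :=
  ∃ N : Set X, IsOpen N ∧ closure Ω ⊆ N ∧ ContMDiffOn 𝓘(ℝ, E) 𝓘(ℝ, ℝ) ∞ ρ N ∧
    Ω = {x ∈ N | ρ x < 0} ∧ ∀ x ∈ frontier Ω, mfderiv 𝓘(ℝ, E) 𝓘(ℝ, ℝ) ρ x ≠ 0

/-- `Ω` has smooth boundary. -/
def HasSmoothBoundary (Ω : Set X) : Prop :=
  ∃ ρ : X → ℝ, IsDefiningFunction E ρ Ω

end Boundary

/-- The function `dist(·, ∂Ω)`. -/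
def boundaryDist {Y : Type*} [EMetricSpace Y] (Ω : Set Y) (x : Y) : ℝ :=
  (Metric.infEDist x (frontier Ω)).toReal

section Form

variable {p : ℕ}

/-- The coordinate expression, on the target of the preferred chart `ψ` at `c`, of a `p`-form on
`X`: the pullback of the form by `ψ⁻¹`. -/
def chartForm (φ : ∀ x : X, TangentSpace 𝓘(ℝ, E) x [⋀^Fin p]→L[ℝ] ℝ) (c : X) (y : E) :
    E [⋀^Fin p]→L[ℝ] ℝ :=
  (φ ((extChartAt 𝓘(ℝ, E) c).symm y)).compContinuousLinearMap
    (mfderiv 𝓘(ℝ, E) 𝓘(ℝ, E) (extChartAt 𝓘(ℝ, E) c).symm y)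

end Form

variable [RiemannianBundle (fun x : X ↦ TangentSpace 𝓘(ℝ, E) x)]

/-- The Riemannian metric as a bilinear form on the tangent space at `x`. -/
def metricAt (x : X) :
    TangentSpace 𝓘(ℝ, E) x →L[ℝ] TangentSpace 𝓘(ℝ, E) x →L[ℝ] ℝ :=
  innerSL ℝ

theorem metricAt_apply (x : X) (v w : TangentSpace 𝓘(ℝ, E) x) : metricAt x v w = inner ℝ v w :=
  rfl

/-- The coordinate expression `(g_{ij})` of the Riemannian metric, on the target of the preferred
chart at `c`. -/
def chartMetric (c : X) (y : E) : E →L[ℝ] E →L[ℝ] ℝ :=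
  let D : E →L[ℝ] TangentSpace 𝓘(ℝ, E) ((extChartAt 𝓘(ℝ, E) c).symm y) :=
    mfderiv 𝓘(ℝ, E) 𝓘(ℝ, E) (extChartAt 𝓘(ℝ, E) c).symm y
  (D.precomp ℝ).comp ((metricAt ((extChartAt 𝓘(ℝ, E) c).symm y)).comp D)

/-- The Riemannian Hessian `Hess f (V, W) = V (W f) - (∇_V W) f` as a bilinear form on the tangent
space at `x`, computed in the preferred chart at `c`.  For `x` in the domain of the chart and `f`
smooth near `x`, it does not depend on the chart. -/
def hessianForm (c : X) (f : X → ℝ) (x : X) :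
    TangentSpace 𝓘(ℝ, E) x →L[ℝ] TangentSpace 𝓘(ℝ, E) x →L[ℝ] ℝ :=
  let D : TangentSpace 𝓘(ℝ, E) x →L[ℝ] E :=
    mfderiv 𝓘(ℝ, E) 𝓘(ℝ, E) (extChartAt 𝓘(ℝ, E) c) x
  (D.precomp ℝ).comp ((hessianOf (chartMetric c) (f ∘ (extChartAt 𝓘(ℝ, E) c).symm)
    (extChartAt 𝓘(ℝ, E) c x)).comp D)

/-- The Hessian of `f` at `x` as an endomorphism of the tangent space:
`⟨Hess f (V), W⟩ = Hess f (V, W)`. -/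
def hessian (c : X) (f : X → ℝ) (x : X) :
    TangentSpace 𝓘(ℝ, E) x →L[ℝ] TangentSpace 𝓘(ℝ, E) x :=
  (metricAt x).inverse.comp (hessianForm c f x)

variable {p : ℕ}

/-- `φ` is a calibration of degree `p`: a smooth closed `p`-form whose value on every unit simple
`p`-vector `e₁ ∧ ⋯ ∧ e_p` (with `e` orthonormal) is at most `1`. -/
structure IsCalibration (φ : ∀ x : X, TangentSpace 𝓘(ℝ, E) x [⋀^Fin p]→L[ℝ] ℝ) : Prop where
  smooth : ∀ c : X, ContDiffOn ℝ ∞ (chartForm φ c) (extChartAt 𝓘(ℝ, E) c).target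
  closed : ∀ c : X, ∀ y ∈ (extChartAt 𝓘(ℝ, E) c).target, extDeriv (chartForm φ c) y = 0
  comass_le_one : ∀ (x : X) (e : Fin p → TangentSpace 𝓘(ℝ, E) x), Orthonormal ℝ e → φ x e ≤ 1

/-- `φ` is parallel, `∇φ = 0`: in every chart, the covariant derivative
`(∇_u φ)(v₁, …, v_p) = (∂_u φ)(v₁, …, v_p) - ∑ i, φ(v₁, …, Γ(u, vᵢ), …, v_p)` vanishes. -/
def IsParallel (φ : ∀ x : X, TangentSpace 𝓘(ℝ, E) x [⋀^Fin p]→L[ℝ] ℝ) : Prop :=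
  ∀ c : X, ∀ y ∈ (extChartAt 𝓘(ℝ, E) c).target, ∀ (u : E) (v : Fin p → E),
    fderiv ℝ (chartForm φ c) y u v
      - derivationAction (chartForm φ c y) (christoffelOf (chartMetric c) y u) v = 0

/-- The orthonormal frame `e` at `x` spans a `φ`-plane: the unit simple vector
`ξ = e₁ ∧ ⋯ ∧ e_p` satisfies `φ(ξ) = 1`, that is, `ξ ∈ G(φ)`.  Every element of `G(φ)` is of this
form. -/
def IsPhiPlane (φ : ∀ x : X, TangentSpace 𝓘(ℝ, E) x [⋀^Fin p]→L[ℝ] ℝ) (x : X)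
    (e : Fin p → TangentSpace 𝓘(ℝ, E) x) : Prop :=
  Orthonormal ℝ e ∧ φ x e = 1

/-- The `φ`-Hessian `λ_φ(Hess f)` of `f` at `x`, evaluated on `e₁ ∧ ⋯ ∧ e_p` (computed in the
preferred chart at `c`; see `hessianForm`). -/
def phiHessian (φ : ∀ x : X, TangentSpace 𝓘(ℝ, E) x [⋀^Fin p]→L[ℝ] ℝ) (c : X) (f : X → ℝ)
    (x : X) (e : Fin p → TangentSpace 𝓘(ℝ, E) x) : ℝ :=
  derivationAction (φ x) (hessian c f x) e

/-- `f` is (smooth and) strictly `φ`-plurisubharmonic on the open set `W`: its `φ`-Hessian is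
positive on all `φ`-planes at points of `W`. -/
def IsStrictlyPhiPSHOn (φ : ∀ x : X, TangentSpace 𝓘(ℝ, E) x [⋀^Fin p]→L[ℝ] ℝ) (f : X → ℝ)
    (W : Set X) : Prop :=
  ContMDiffOn 𝓘(ℝ, E) 𝓘(ℝ, ℝ) ∞ f W ∧
    ∀ x ∈ W, ∀ c : X, x ∈ (extChartAt 𝓘(ℝ, E) c).source →
      ∀ e : Fin p → TangentSpace 𝓘(ℝ, E) x, IsPhiPlane φ x e → 0 < phiHessian φ c f x e

/-- The boundary of `Ω` is `φ`-convex: it is smooth, and for a defining function `ρ` (equivalently,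
for every one) the `φ`-Hessian of `ρ` is non-negative on all `φ`-planes `ξ` at boundary points that
are tangential, that is, `span ξ ⊆ T_x ∂Ω = ker dρ_x`. -/
def HasPhiConvexBoundary (φ : ∀ x : X, TangentSpace 𝓘(ℝ, E) x [⋀^Fin p]→L[ℝ] ℝ)
    (Ω : Set X) : Prop :=
  HasSmoothBoundary E Ω ∧ ∀ ρ : X → ℝ, IsDefiningFunction E ρ Ω →
    ∀ x ∈ frontier Ω, ∀ c : X, x ∈ (extChartAt 𝓘(ℝ, E) c).source →
      ∀ e : Fin p → TangentSpace 𝓘(ℝ, E) x, IsPhiPlane φ x e →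
        (∀ i, mfderiv 𝓘(ℝ, E) 𝓘(ℝ, ℝ) ρ x (e i) = 0) → 0 ≤ phiHessian φ c ρ x e

end

end CalibratedGeometry

/-! Suppose the trace of Hess ρ over some tangential φ-plane ξ at x ∈ ∂Ω is negative. In a chart
taking x to y₀, put s = -ρ/|∇ρ(x)|: then s > 0 in Ω near x, |ds| = 1 at y₀, and Hess s has positive
trace over ξ. Since Hess(-log s) = -Hess s/s + ds ⊗ ds/s², its trace is negative on φ-planes near ξ
on which ds is small enough. The function F = -log δ is only known to be uniformly close to -log s,
with no control of derivatives up to the boundary. Hessians are therefore compared at a maximum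
point instead of being passed to a limit.

Three facts feed this comparison. By the first cousin principle (`map_update_eq_inner`) the
φ-Hessian on a φ-plane is the trace of the Hessian. Since ∇φ = 0, parallel transport extends ξ to a
Lipschitz family of φ-planes (`exists_parallel_frame`), so ds on the transported plane at y is O(|y
- y₀|). Finally, for every η > 0, F ≤ -log s + η on {s > 0} near y₀
(`eventually_abs_le_mul_boundaryDist`), and F ≥ -log t - η at y₀ + tn for small t > 0, with n the
inward unit normal (`edist_symm_add_smul_le`).

In `false_of_trace_hessianOf_pos` a barrier F₂ at scale t is subtracted from F. The two bounds force
the maximum of F - F₂ to an interior point z with s(z) comparable to t and |z - y₀|² ≲ ηt. There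
Hess F ≤ Hess F₂, while the trace of Hess F₂ over the transported plane is at most 0 by
`trace_estimate_nonpos`, contradicting plurisubharmonicity. -/

namespace CalibratedGeometry

set_option linter.unusedSectionVars false

/-! ### Second-order comparison and the barrier argument in coordinates. -/

section Calculus

variable {E : Type*} [NormedAddCommGroup E] [NormedSpace ℝ E]

/-- The second derivative of a function is non-positive at a local maximum. -/
theorem fderiv_fderiv_apply_self_nonpos_of_isLocalMax {h : E → ℝ} {y : E}
    (hc : ContDiffAt ℝ 2 h y) (hm : IsLocalMax h y) (u : E) :
    fderiv ℝ (fderiv ℝ h) y u u ≤ 0 := by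
  by_contra! hpos
  have hl : ∀ t : ℝ, HasDerivAt (fun t : ℝ ↦ y + t • u) u t := fun t ↦ by
    simpa using ((hasDerivAt_id t).smul_const u).const_add y
  have h0 : y + (0 : ℝ) • u = y := by simp
  have hcl : ContinuousAt (fun t : ℝ ↦ y + t • u) 0 := (hl 0).continuousAt
  have hev : ∀ᶠ z in 𝓝 y, DifferentiableAt ℝ h z :=
    (hc.eventually (by simp)).mono fun z hz ↦ hz.differentiableAt (by simp)
  have hd : ∀ᶠ t in 𝓝 (0 : ℝ),
      HasDerivAt (fun t : ℝ ↦ h (y + t • u)) (fderiv ℝ h (y + t • u) u) t := by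
    have := hcl.tendsto.eventually (by rwa [h0])
    filter_upwards [this] with t ht using ht.hasFDerivAt.comp_hasDerivAt t (hl t)
  have hde : deriv (fun t : ℝ ↦ h (y + t • u)) =ᶠ[𝓝 0] fun t ↦ fderiv ℝ h (y + t • u) u :=
    hd.mono fun t ht ↦ ht.deriv
  have hdd : DifferentiableAt ℝ (fderiv ℝ h) y :=
    (hc.fderiv_right (m := 1) (by norm_num)).differentiableAt (by simp)
  have h2 : HasDerivAt (fun t : ℝ ↦ fderiv ℝ h (y + t • u) u)
      (fderiv ℝ (fderiv ℝ h) y u u) 0 := by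
    have h3 : HasDerivAt (fun t : ℝ ↦ fderiv ℝ h (y + t • u)) (fderiv ℝ (fderiv ℝ h) y u) 0 := by
      have h4 : HasFDerivAt (fderiv ℝ h) (fderiv ℝ (fderiv ℝ h) y) (y + (0 : ℝ) • u) := by
        rw [h0]; exact hdd.hasFDerivAt
      exact h4.comp_hasDerivAt 0 (hl 0)
    simpa using h3.clm_apply (hasDerivAt_const 0 u)
  have h2' : deriv (deriv fun t : ℝ ↦ h (y + t • u)) 0 = fderiv ℝ (fderiv ℝ h) y u u := by
    rw [hde.deriv_eq]; exact h2.deriv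
  have hmax : IsLocalMax (fun t : ℝ ↦ h (y + t • u)) 0 := by
    have := hcl.tendsto.eventually (p := fun z ↦ h z ≤ h y) (by rw [h0]; exact hm)
    filter_upwards [this] with t ht
    simpa using ht
  -- A positive second derivative makes the maximum a local minimum as well, so the restriction to
  -- the line is locally constant, which is absurd.
  have hmin : IsLocalMin (fun t : ℝ ↦ h (y + t • u)) 0 :=
    isLocalMin_of_deriv_deriv_pos (by rwa [h2']) hmax.deriv_eq_zero hd.self_of_nhds.continuousAt
  have hconst : (fun t : ℝ ↦ h (y + t • u)) =ᶠ[𝓝 0] fun _ ↦ h (y + (0 : ℝ) • u) := by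
    filter_upwards [hmax, hmin] with t h1 h2 using le_antisymm h1 h2
  have : deriv (deriv fun t : ℝ ↦ h (y + t • u)) 0 = 0 := by
    rw [hconst.deriv.deriv_eq]; simp
  linarith

/-- Comparison of Hessians at a local maximum of a difference. -/
theorem hessianOf_apply_self_le_of_isLocalMax_sub (g : E → E →L[ℝ] E →L[ℝ] ℝ) {F G : E → ℝ}
    {y : E} (hF : ContDiffAt ℝ 2 F y) (hG : ContDiffAt ℝ 2 G y)
    (hm : IsLocalMax (fun z ↦ F z - G z) y) (u : E) :
    hessianOf g F y u u ≤ hessianOf g G y u u := by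
  have hev : fderiv ℝ (fun z ↦ F z - G z) =ᶠ[𝓝 y] fun z ↦ fderiv ℝ F z - fderiv ℝ G z := by
    filter_upwards [hF.eventually (by simp), hG.eventually (by simp)] with z h1 h2
    exact fderiv_fun_sub (h1.differentiableAt (by simp)) (h2.differentiableAt (by simp))
  have h1 : fderiv ℝ F y = fderiv ℝ G y := by
    have := hev.self_of_nhds
    rw [hm.fderiv_eq_zero] at this
    exact (sub_eq_zero.mp this.symm)
  have h2 := fderiv_fderiv_apply_self_nonpos_of_isLocalMax (hF.sub hG) hm u
  have hFd : DifferentiableAt ℝ (fderiv ℝ F) y :=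
    (hF.fderiv_right (m := 1) (by norm_num)).differentiableAt (by simp)
  have hGd : DifferentiableAt ℝ (fderiv ℝ G) y :=
    (hG.fderiv_right (m := 1) (by norm_num)).differentiableAt (by simp)
  have h3 : fderiv ℝ (fderiv ℝ fun z ↦ F z - G z) y =
      fderiv ℝ (fderiv ℝ F) y - fderiv ℝ (fderiv ℝ G) y := by
    rw [hev.fderiv_eq]; exact fderiv_fun_sub hFd hGd
  have h4 : fderiv ℝ (fderiv ℝ fun z ↦ F z - G z) y u u ≤ 0 := h2
  rw [h3] at h4
  simp only [sub_apply] at h4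
  -- The Christoffel terms see only first derivatives, which agree at `y`, so they cancel.
  rw [hessianOf_apply, hessianOf_apply, h1]
  linarith

/-- The Hessian of a combination of `log s`, `s` and `q`. -/
theorem hessianOf_log_add_apply_self (g : E → E →L[ℝ] E →L[ℝ] ℝ) {s q : E → ℝ} {y : E}
    (hs : ContDiffAt ℝ 2 s y) (hq : ContDiffAt ℝ 2 q y) (hy : 0 < s y) (a b k : ℝ) (u : E) :
    hessianOf g (fun z ↦ a * Real.log (s z) + b * s z + k * q z) y u u =
      (a / s y + b) * hessianOf g s y u u - a / s y ^ 2 * (fderiv ℝ s y u) ^ 2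
        + k * hessianOf g q y u u := by
  have hev : fderiv ℝ (fun z ↦ a * Real.log (s z) + b * s z + k * q z) =ᶠ[𝓝 y]
      fun z ↦ (a * (s z)⁻¹ + b) • fderiv ℝ s z + k • fderiv ℝ q z := by
    filter_upwards [hs.eventually (by simp), hq.eventually (by simp),
      hs.continuousAt.eventually (lt_mem_nhds hy)] with z h1 h2 h3
    have d1 := (h1.differentiableAt (by simp)).hasFDerivAt
    have d2 := (h2.differentiableAt (by simp)).hasFDerivAt
    have := (((d1.log h3.ne').const_mul a).add (d1.const_mul b)).add (d2.const_mul k)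
    refine this.fderiv.trans ?_
    ext w
    simp
    ring
  have d1 := (hs.differentiableAt (by simp)).hasFDerivAt
  have hsd : HasFDerivAt (fderiv ℝ s) (fderiv ℝ (fderiv ℝ s) y) y :=
    ((hs.fderiv_right (m := 1) (by norm_num)).differentiableAt (by simp)).hasFDerivAt
  have hqd : HasFDerivAt (fderiv ℝ q) (fderiv ℝ (fderiv ℝ q) y) y :=
    ((hq.fderiv_right (m := 1) (by norm_num)).differentiableAt (by simp)).hasFDerivAt
  have hinv : HasFDerivAt (fun z ↦ a * (s z)⁻¹ + b) (-(a / s y ^ 2) • fderiv ℝ s y) y := by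
    have := (((hasDerivAt_inv hy.ne').comp_hasFDerivAt y d1).const_mul a).add_const b
    refine this.congr_fderiv ?_
    ext w
    simp
    ring
  have h3 := (hinv.smul hsd).add (hqd.const_smul k)
  have h4 := hev.fderiv_eq.trans h3.fderiv
  rw [hessianOf_apply, h4, hev.self_of_nhds, hessianOf_apply, hessianOf_apply]
  simp
  field_simp
  ring

theorem continuousAt_hessianOf {g : E → E →L[ℝ] E →L[ℝ] ℝ} {h : E → ℝ} {y : E}
    (hh : ContDiffAt ℝ 2 h y) (hg : ContinuousAt (christoffelOf g) y) :
    ContinuousAt (hessianOf g h) y := by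
  have h1 : ContDiffAt ℝ 1 (fderiv ℝ h) y := hh.fderiv_right (by norm_num)
  have h2 : ContinuousAt (fderiv ℝ (fderiv ℝ h)) y :=
    (h1.fderiv_right (m := 0) (by norm_num)).continuousAt
  have h3 : ContinuousAt (fun z ↦ ContinuousLinearMap.compL ℝ E E ℝ (fderiv ℝ h z)) y :=
    (ContinuousLinearMap.compL ℝ E E ℝ).continuous.continuousAt.comp h1.continuousAt
  exact h2.sub (h3.clm_comp hg)

/-- The tangent lines of log at 1/2 and 2 bound σ - 1 - log σ below by log 2 - 1/2 for σ ≤ 1/2 and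
by 1 - log 2 for σ ≥ 2; both exceed 1/10. -/
theorem one_half_lt_and_lt_two_of_sub_log_lt {σ : ℝ} (hσ : 0 < σ) (h : σ - 1 - Real.log σ < 1 / 10) :
    1 / 2 < σ ∧ σ < 2 := by
  have l1 := Real.log_two_gt_d9
  have l2 := Real.log_two_lt_d9
  constructor
  · by_contra! hle
    have := Real.log_le_sub_one_of_pos (show 0 < σ * 2 by positivity)
    rw [Real.log_mul hσ.ne' (by norm_num)] at this
    linarith
  · by_contra! hle
    have := Real.log_le_sub_one_of_pos (show 0 < σ / 2 by positivity)
    rw [Real.log_div hσ.ne' (by norm_num)] at this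
    linarith

/-- This is the trace of the barrier's Hessian at the maximum point, with σ = s(z) and N = |z -
y₀|². All terms scale like 1/t: the Hess s term is at most -c₀/(4t), and since N is O(ηt) the
gradient and penalty terms are each at most c₀/(16t). -/
theorem trace_estimate_nonpos {t c k η c₀ C₁ C₂ σ Ts Tq D N : ℝ} (ht : 0 < t) (hc : 0 < c)
    (hk : 0 < k) (hc₀ : 0 < c₀) (hC₁ : 0 ≤ C₁) (h1 : t / 2 < σ) (h2 : σ < 2 * t)
    (hTs : c₀ ≤ Ts) (hTq : Tq ≤ C₂) (hD : 0 ≤ D) (hDN : D ≤ C₁ * N)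
    (hN : c * N ≤ 5 * η / k * t) (hη2 : 30 * C₁ * η / (c * k) ≤ c₀ / 16)
    (hkC : k * C₂ = c₀ / 16) :
    (-(3 / 2) / σ + 1 / (2 * t)) * Ts - -(3 / 2) / σ ^ 2 * D + k / t * Tq ≤ 0 := by
  have hσ : 0 < σ := by linarith
  have t1 : (-(3 / 2) / σ + 1 / (2 * t)) * Ts ≤ -(c₀ / 4 / t) := by
    have h1 : -(3 / 2) / σ + 1 / (2 * t) ≤ -(1 / 4 / t) := by
      have : 3 / 2 / (2 * t) ≤ 3 / 2 / σ := by gcongr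
      have h2 : (3 : ℝ) / 2 / (2 * t) - 1 / (2 * t) = 1 / 4 / t := by field_simp; norm_num
      rw [neg_div]
      linarith
    have h3 : -(1 / 4 / t) ≤ 0 := neg_nonpos.mpr (by positivity)
    calc _ ≤ -(1 / 4 / t) * Ts := mul_le_mul_of_nonneg_right h1 (hc₀.le.trans hTs)
      _ ≤ -(1 / 4 / t) * c₀ := mul_le_mul_of_nonpos_left hTs h3
      _ = _ := by ring
  have t2 : 3 / 2 / σ ^ 2 * D ≤ c₀ / 16 / t := by
    have h3 : D ≤ C₁ * (5 * η / k * t / c) := by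
      refine hDN.trans (mul_le_mul_of_nonneg_left ?_ hC₁)
      rw [le_div_iff₀ hc]
      linarith
    have h4 : 3 / 2 / σ ^ 2 ≤ 6 / t ^ 2 := by
      calc 3 / 2 / σ ^ 2 ≤ 3 / 2 / (t / 2) ^ 2 := by gcongr
        _ = 6 / t ^ 2 := by field_simp; norm_num
    calc 3 / 2 / σ ^ 2 * D ≤ 6 / t ^ 2 * (C₁ * (5 * η / k * t / c)) :=
          mul_le_mul h4 h3 hD (by positivity)
      _ = 30 * C₁ * η / (c * k) / t := by field_simp; ring
      _ ≤ _ := by gcongr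
  have t3 : k / t * Tq ≤ c₀ / 16 / t := by
    calc k / t * Tq ≤ k / t * C₂ := by gcongr
      _ = c₀ / 16 / t := by rw [← hkC]; ring
  have t5 : -(3 / 2) / σ ^ 2 * D = -(3 / 2 / σ ^ 2 * D) := by ring
  have t6 : c₀ / 4 / t = 4 * (c₀ / 16 / t) := by ring
  have t7 : 0 < c₀ / 16 / t := by positivity
  rw [t5]
  linarith

/-- There is no function `F ~ -log s` on `{s > 0}` whose Hessian has positive trace along a
Lipschitz family of frames `ε` that is tangent to `{s = 0}` at `y₀`, if the trace of the Hessian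
of `s` along `ε y₀` is positive. -/
theorem false_of_trace_hessianOf_pos [FiniteDimensional ℝ E] (g : E → E →L[ℝ] E →L[ℝ] ℝ)
    {s F : E → ℝ} {y₀ n : E} {p : ℕ} {ε : E → Fin p → E} (hs : ContDiffAt ℝ 2 s y₀)
    (hs0 : s y₀ = 0) (hn : fderiv ℝ s y₀ n = 1) (hΓ : ContinuousAt (christoffelOf g) y₀)
    (B : E →L[ℝ] E →L[ℝ] ℝ) {c : ℝ} (hc : 0 < c) (hB : ∀ u, c * ‖u‖ ^ 2 ≤ B u u)
    (hε : ∃ C : ℝ, ∀ᶠ y in 𝓝 y₀, ∀ i, ‖ε y i - ε y₀ i‖ ≤ C * ‖y - y₀‖)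
    (htan : ∀ i, fderiv ℝ s y₀ (ε y₀ i) = 0)
    (htr : 0 < ∑ i, hessianOf g s y₀ (ε y₀ i) (ε y₀ i))
    (hF : ∀ᶠ y in 𝓝 y₀, 0 < s y →
      ContDiffAt ℝ 2 F y ∧ 0 < ∑ i, hessianOf g F y (ε y i) (ε y i))
    (hup : ∀ η > 0, ∀ᶠ y in 𝓝 y₀, 0 < s y → F y ≤ -Real.log (s y) + η)
    (hlow : ∀ η > 0, ∀ᶠ t in 𝓝[>] (0 : ℝ),
      0 < s (y₀ + t • n) → -Real.log t - η ≤ F (y₀ + t • n)) : False := by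
  obtain ⟨C, hC⟩ := hε
  have hO : ∀ i, (fun y ↦ ε y i - ε y₀ i) =O[𝓝 y₀] fun y ↦ y - y₀ := fun i ↦
    Asymptotics.IsBigO.of_bound C (hC.mono fun y hy ↦ hy i)
  have hεc : ∀ i, ContinuousAt (fun y ↦ ε y i) y₀ := fun i ↦ by
    have h0 : Filter.Tendsto (fun y ↦ y - y₀) (𝓝 y₀) (𝓝 0) := by
      have : Continuous fun y : E ↦ y - y₀ := by fun_prop
      simpa using this.tendsto y₀
    have := (hO i).trans_tendsto h0
    have h2 := this.add_const (ε y₀ i)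
    simp only [sub_add_cancel, zero_add] at h2
    exact h2
  set q : E → ℝ := fun y ↦ B (y - y₀) (y - y₀) with hq_def
  have hq : ∀ y, ContDiffAt ℝ 2 q y := fun y ↦ by
    have : ContDiff ℝ 2 q := by fun_prop
    exact this.contDiffAt
  have htrc : ∀ h : E → ℝ, ContDiffAt ℝ 2 h y₀ →
      ContinuousAt (fun y ↦ ∑ i, hessianOf g h y (ε y i) (ε y i)) y₀ := fun h hh ↦
    tendsto_finsetSum _ fun i _ ↦
      ((continuousAt_hessianOf hh hΓ).clm_apply (hεc i)).clm_apply (hεc i)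
  set c₀ := (∑ i, hessianOf g s y₀ (ε y₀ i) (ε y₀ i)) / 2 with hc0
  have hc0pos : 0 < c₀ := by positivity
  have e1 : ∀ᶠ y in 𝓝 y₀, c₀ < ∑ i, hessianOf g s y (ε y i) (ε y i) :=
    (htrc s hs).eventually (lt_mem_nhds (by rw [hc0]; linarith))
  obtain ⟨C₂, hC2pos, e2⟩ : ∃ C₂ > 0, ∀ᶠ y in 𝓝 y₀,
      ∑ i, hessianOf g q y (ε y i) (ε y i) < C₂ :=
    ⟨|∑ i, hessianOf g q y₀ (ε y₀ i) (ε y₀ i)| + 1, by positivity,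
      (htrc q (hq y₀)).eventually (gt_mem_nhds (by
        have := le_abs_self (∑ i, hessianOf g q y₀ (ε y₀ i) (ε y₀ i))
        linarith))⟩
  -- Tangency makes ds(ε) vanish at `y₀`, and both ds and ε are Lipschitz there, so ds(ε) is O(|y -
  -- y₀|).
  obtain ⟨C₁, hC1pos, e3⟩ : ∃ C₁ > 0, ∀ᶠ y in 𝓝 y₀,
      ∑ i, (fderiv ℝ s y (ε y i)) ^ 2 ≤ C₁ * ‖y - y₀‖ ^ 2 := by
    have hd : (fun y ↦ fderiv ℝ s y - fderiv ℝ s y₀) =O[𝓝 y₀] fun y ↦ y - y₀ :=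
      ((hs.fderiv_right (m := 1) (by norm_num)).differentiableAt (by simp)).isBigO_sub
    have h1 : ∀ i, (fun y ↦ fderiv ℝ s y (ε y i)) =O[𝓝 y₀] fun y ↦ ‖y - y₀‖ := fun i ↦ by
      obtain ⟨A, hA⟩ := hd.bound
      obtain ⟨D, hD⟩ := (hO i).bound
      have hbd : ∀ᶠ y in 𝓝 y₀, ‖ε y i‖ < ‖ε y₀ i‖ + 1 :=
        (hεc i).norm.eventually (gt_mem_nhds (by linarith))
      refine Asymptotics.IsBigO.of_bound (|A| * (‖ε y₀ i‖ + 1) + ‖fderiv ℝ s y₀‖ * |D|) ?_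
      filter_upwards [hA, hD, hbd] with y h1 h2 h3
      have h4 : fderiv ℝ s y (ε y i) =
          (fderiv ℝ s y - fderiv ℝ s y₀) (ε y i) + fderiv ℝ s y₀ (ε y i - ε y₀ i) := by
        simp [htan i]
      have h5 : ‖(fderiv ℝ s y - fderiv ℝ s y₀) (ε y i)‖ ≤
          |A| * ‖y - y₀‖ * (‖ε y₀ i‖ + 1) := by
        refine (ContinuousLinearMap.le_opNorm _ _).trans ?_
        have : A * ‖y - y₀‖ ≤ |A| * ‖y - y₀‖ := by gcongr; exact le_abs_self A
        gcongr
        exact h1.trans this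
      have h6 : ‖fderiv ℝ s y₀ (ε y i - ε y₀ i)‖ ≤ ‖fderiv ℝ s y₀‖ * (|D| * ‖y - y₀‖) := by
        refine (ContinuousLinearMap.le_opNorm _ _).trans ?_
        have : D * ‖y - y₀‖ ≤ |D| * ‖y - y₀‖ := by gcongr; exact le_abs_self D
        gcongr
        exact h2.trans this
      rw [h4, norm_norm]
      refine (norm_add_le _ _).trans ?_
      nlinarith [h5, h6]
    have h2 : (fun y ↦ ∑ i, (fderiv ℝ s y (ε y i)) ^ 2) =O[𝓝 y₀] fun y ↦ ‖y - y₀‖ ^ 2 :=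
      Asymptotics.IsBigO.fun_sum fun i _ ↦ (h1 i).pow 2
    obtain ⟨A, hA, h3⟩ := h2.exists_pos
    refine ⟨A, hA, h3.bound.mono fun y hy ↦ ?_⟩
    have := (le_abs_self _).trans hy
    simpa using this
  -- This weight keeps the penalty's contribution to the trace below c₀/(16t). In `η`, the bound
  -- 1/200 localizes s(z)/t, and the other one does the same for the gradient term.
  set k := c₀ / (16 * C₂) with hk_def
  have hk : 0 < k := by positivity
  set η := min (1 / 200) (c * k * c₀ / (480 * C₁)) with hη_def
  have hη : 0 < η := by positivity
  have hη1 : η ≤ 1 / 200 := min_le_left _ _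
  have hη2 : 30 * C₁ * η / (c * k) ≤ c₀ / 16 := by
    have := min_le_right (1 / 200) (c * k * c₀ / (480 * C₁))
    rw [← hη_def] at this
    calc 30 * C₁ * η / (c * k) ≤ 30 * C₁ * (c * k * c₀ / (480 * C₁)) / (c * k) := by gcongr
      _ = c₀ / 16 := by field_simp; norm_num
  obtain ⟨R, hR, hball⟩ := Metric.nhds_basis_closedBall.eventually_iff.mp
    ((hs.eventually (by simp)).and (hF.and ((hup η hη).and (e1.and (e2.and e3)))))
  have hl : HasDerivAt (fun t : ℝ ↦ y₀ + t • n) n 0 := by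
    simpa using ((hasDerivAt_id (0 : ℝ)).smul_const n).const_add y₀
  have hl0 : y₀ + (0 : ℝ) • n = y₀ := by simp
  have hquot : Filter.Tendsto (fun t : ℝ ↦ s (y₀ + t • n) / t) (𝓝[>] 0) (𝓝 1) := by
    have h1 : HasDerivAt (fun t : ℝ ↦ s (y₀ + t • n)) 1 0 := by
      have h2 : HasFDerivAt s (fderiv ℝ s y₀) (y₀ + (0 : ℝ) • n) := by
        rw [hl0]; exact (hs.differentiableAt (by simp)).hasFDerivAt
      have := h2.comp_hasDerivAt 0 hl
      rwa [hn] at this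
    have h3 := hasDerivWithinAt_iff_tendsto_slope.mp (h1.hasDerivWithinAt (s := Ioi 0))
    simp only [Set.mem_Ioi, lt_self_iff_false, not_false_eq_true, Set.sdiff_singleton_eq_self] at h3
    refine h3.congr' ?_
    filter_upwards with t
    simp [slope_def_field, hs0]
  have f1 := hquot.eventually (lt_mem_nhds (show 1 - η < 1 by linarith))
  have f2 := hquot.eventually (gt_mem_nhds (show (1 : ℝ) < 1 + η by linarith))
  have f3 := (hquot.log one_ne_zero).eventually (lt_mem_nhds (show -η < Real.log 1 by simpa))
  have hid : Filter.Tendsto (fun t : ℝ ↦ t) (𝓝[>] 0) (𝓝 0) :=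
    (Filter.tendsto_id (α := ℝ)).mono_left nhdsWithin_le_nhds
  have f4 : ∀ᶠ t in 𝓝[>] (0 : ℝ), k * B n n * t < η :=
    (by simpa using hid.const_mul (k * B n n) :
      Filter.Tendsto (fun t : ℝ ↦ k * B n n * t) (𝓝[>] 0) (𝓝 0)).eventually (gt_mem_nhds hη)
  have f5 : ∀ᶠ t in 𝓝[>] (0 : ℝ), 5 * η / k * t < c * R ^ 2 :=
    (by simpa using hid.const_mul (5 * η / k) :
      Filter.Tendsto (fun t : ℝ ↦ 5 * η / k * t) (𝓝[>] 0) (𝓝 0)).eventually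
        (gt_mem_nhds (by positivity))
  have f6 : ∀ᶠ t in 𝓝[>] (0 : ℝ), y₀ + t • n ∈ Metric.closedBall y₀ R := by
    have := hl.continuousAt.tendsto.mono_left (nhdsWithin_le_nhds (s := Ioi 0))
    rw [hl0] at this
    exact this.eventually (Metric.closedBall_mem_nhds y₀ hR)
  obtain ⟨t, ht, g1, g2, g3, g4, g5, g6, g7⟩ := (eventually_mem_nhdsWithin.and
    (f1.and (f2.and (f3.and (f4.and (f5.and (f6.and (hlow η hη)))))))).exists
  replace ht : 0 < t := ht
  rw [lt_div_iff₀ ht] at g1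
  rw [div_lt_iff₀ ht] at g2
  have hst : 0 < s (y₀ + t • n) := lt_of_lt_of_le (by nlinarith) g1.le
  rw [Real.log_div hst.ne' ht.ne'] at g3
  replace g7 := g7 hst
  -- With F replaced by -log s, the difference F - F₂ is (log s - s/t)/2 - kq/t. Taking 3/2 rather
  -- than 1 leaves a multiple of log s, and the linear term puts the peak at s = t, while q
  -- penalizes distance from `y₀`.
  set F₂ : E → ℝ := fun z ↦ -(3 / 2) * Real.log (s z) + 1 / (2 * t) * s z + k / t * q z with hF2
  have hsc : ContinuousOn s (Metric.closedBall y₀ R) := fun y hy ↦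
    (hball hy).1.continuousAt.continuousWithinAt
  -- The cut at t/3 keeps K away from {s = 0} and lies below the height t/2 that the maximum point
  -- will exceed.
  set K := Metric.closedBall y₀ R ∩ s ⁻¹' Ici (t / 3) with hK
  have hKc : IsCompact K := by
    refine (isCompact_closedBall y₀ R).of_isClosed_subset ?_ inter_subset_left
    exact hsc.preimage_isClosed_of_isClosed Metric.isClosed_closedBall isClosed_Ici
  have hKpos : ∀ y ∈ K, 0 < s y := fun y hy ↦ lt_of_lt_of_le (by positivity) hy.2
  have hF2d : ∀ y ∈ K, ContDiffAt ℝ 2 F₂ y := fun y hy ↦ by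
    have h1 := (hball hy.1).1
    exact ((contDiffAt_const.mul (h1.log (hKpos y hy).ne')).add (contDiffAt_const.mul h1)).add
      (contDiffAt_const.mul (hq y))
  have hcont : ContinuousOn (fun z ↦ F z - F₂ z) K := fun y hy ↦
    ((((hball hy.1).2.1 (hKpos y hy)).1.continuousAt).sub
      (hF2d y hy).continuousAt).continuousWithinAt
  have hmem : y₀ + t • n ∈ K := ⟨g6, by
    change t / 3 ≤ s (y₀ + t • n)
    nlinarith⟩
  obtain ⟨z, hz, hzmax⟩ := hKc.exists_isMaxOn ⟨_, hmem⟩ hcont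
  obtain ⟨z1, z2, z3, z4, z5, z6⟩ := hball hz.1
  have hsz := hKpos z hz
  have hqz : c * ‖z - y₀‖ ^ 2 ≤ q z := hB _
  have hcmp : F (y₀ + t • n) - F₂ (y₀ + t • n) ≤ F z - F₂ z := hzmax hmem
  have hqt : k / t * q (y₀ + t • n) < η := by
    have : k / t * q (y₀ + t • n) = k * B n n * t := by
      simp only [hq_def, add_sub_cancel_left, map_smul, FunLike.coe_smul, Pi.smul_apply,
        smul_eq_mul]
      field_simp
    rwa [this]
  have hst2 : 1 / (2 * t) * s (y₀ + t • n) ≤ (1 + η) / 2 := by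
    rw [one_div, inv_mul_le_iff₀ (by positivity)]
    nlinarith
  -- The errors are η for the upper bound on F at z, and at y₀ + tn: η for the lower bound on F,
  -- 3η/2 for log s, η/2 for the linear term and η for the penalty.
  have hkey : 1 / 2 * (s z / t - 1 - Real.log (s z / t)) + k / t * q z ≤ 5 * η := by
    have h1 := z3 hsz
    rw [Real.log_div hsz.ne' ht.ne']
    have h2 : 1 / (2 * t) * s z = 1 / 2 * (s z / t) := by field_simp
    simp only [hF2] at hcmp
    rw [h2] at hcmp
    linarith
  have hqz0 : 0 ≤ q z := le_trans (by positivity) hqz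
  have hm0 : 0 ≤ s z / t - 1 - Real.log (s z / t) := by
    have := Real.log_le_sub_one_of_pos (show 0 < s z / t by positivity)
    linarith
  have hkq : 0 ≤ k / t * q z := by positivity
  obtain ⟨b1, b2⟩ := one_half_lt_and_lt_two_of_sub_log_lt (show 0 < s z / t by positivity)
    (by linarith)
  rw [lt_div_iff₀ ht] at b1
  rw [div_lt_iff₀ ht] at b2
  have hqz' : q z ≤ 5 * η / k * t := by
    have : k / t * q z ≤ 5 * η := by linarith
    rw [div_mul_eq_mul_div, div_le_iff₀ ht] at this
    rw [div_mul_eq_mul_div, le_div_iff₀ hk]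
    linarith
  have hzR : ‖z - y₀‖ < R := by
    have : c * ‖z - y₀‖ ^ 2 < c * R ^ 2 := by linarith
    exact lt_of_pow_lt_pow_left₀ 2 hR.le (lt_of_mul_lt_mul_left this hc.le)
  -- Both constraints defining K are strict at z, so the maximum over K is a local maximum.
  have hnhds : K ∈ 𝓝 z := by
    refine Filter.inter_mem (Metric.closedBall_mem_nhds_of_mem (by simpa [dist_eq_norm])) ?_
    exact z1.continuousAt.preimage_mem_nhds (Ici_mem_nhds (by linarith))
  have hloc : IsLocalMax (fun z ↦ F z - F₂ z) z := hzmax.isLocalMax hnhds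
  have hle : ∑ i, hessianOf g F z (ε z i) (ε z i) ≤ ∑ i, hessianOf g F₂ z (ε z i) (ε z i) :=
    Finset.sum_le_sum fun i _ ↦
      hessianOf_apply_self_le_of_isLocalMax_sub g (z2 hsz).1 (hF2d z hz) hloc _
  have hpos := (z2 hsz).2.trans_le hle
  simp only [hF2, hessianOf_log_add_apply_self g z1 (hq z) hsz, Finset.sum_add_distrib,
    Finset.sum_sub_distrib, ← Finset.mul_sum] at hpos
  set Ts := ∑ i, hessianOf g s z (ε z i) (ε z i)
  set Tq := ∑ i, hessianOf g q z (ε z i) (ε z i)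
  set D := ∑ i, (fderiv ℝ s z (ε z i)) ^ 2
  exact absurd hpos (not_lt.mpr (trace_estimate_nonpos ht hc hk hc0pos hC1pos.le
    (by linarith) b2 z4.le z5.le (Finset.sum_nonneg fun i _ ↦ sq_nonneg _) z6 (by linarith)
    hη2 (by rw [hk_def]; field_simp)))

end Calculus

/-! ### Levi-Civita connection in coordinates and parallel transport of frames. -/

section Transport

variable {E : Type*} [NormedAddCommGroup E] [NormedSpace ℝ E]

theorem apply_christoffelOf {g : E → E →L[ℝ] E →L[ℝ] ℝ} {y : E} (hg : (g y).IsInvertible)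
    (u v w : E) : g y (christoffelOf g y u v) w = christoffelLower g y u v w := by
  have : g y ((g y).inverse (christoffelLower g y u v)) = christoffelLower g y u v :=
    congrArg (fun T ↦ T (christoffelLower g y u v)) hg.self_comp_inverse
  exact congrArg (fun T : E →L[ℝ] ℝ ↦ T w) this

/-- The Levi-Civita connection is compatible with the metric. -/
theorem apply_christoffelOf_add {g : E → E →L[ℝ] E →L[ℝ] ℝ} {V : Set E} (hV : IsOpen V)
    (hsymm : ∀ y ∈ V, ∀ u v, g y u v = g y v u) {y : E} (hy : y ∈ V)
    (hgd : DifferentiableAt ℝ g y) (hg : (g y).IsInvertible) (u v w : E) :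
    g y (christoffelOf g y u v) w + g y v (christoffelOf g y u w) = fderiv ℝ g y u v w := by
  have hsd : ∀ a b c, fderiv ℝ g y a b c = fderiv ℝ g y a c b := fun a b c ↦ by
    have h1 : ∀ b c, HasFDerivAt (fun z ↦ g z b c)
        (((ContinuousLinearMap.apply ℝ ℝ c).comp (ContinuousLinearMap.apply ℝ (E →L[ℝ] ℝ) b)).comp
          (fderiv ℝ g y)) y := fun b c ↦
      (((ContinuousLinearMap.apply ℝ ℝ c).comp
        (ContinuousLinearMap.apply ℝ (E →L[ℝ] ℝ) b)).hasFDerivAt).comp y hgd.hasFDerivAt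
    have h2 : (fun z ↦ g z b c) =ᶠ[𝓝 y] fun z ↦ g z c b := by
      filter_upwards [hV.mem_nhds hy] with z hz using hsymm z hz b c
    have h3 := ((h1 c b).congr_of_eventuallyEq h2).unique (h1 b c)
    exact (congrArg (fun T : E →L[ℝ] ℝ ↦ T a) h3).symm
  rw [hsymm y hy v, apply_christoffelOf hg, apply_christoffelOf hg, christoffelLower_apply,
    christoffelLower_apply, hsd u w v, hsd v u w, hsd w u v]
  ring

theorem continuousOn_christoffelOf [CompleteSpace E] {g : E → E →L[ℝ] E →L[ℝ] ℝ} {V : Set E}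
    (hV : IsOpen V) (hg : ContDiffOn ℝ 1 g V) (hinv : ∀ y ∈ V, (g y).IsInvertible) :
    ContinuousOn (christoffelOf g) V := by
  have hf : ContinuousOn (fderiv ℝ g) V := hg.continuousOn_fderiv_of_isOpen hV le_rfl
  have h1 : ContinuousOn (fun y ↦ (g y).inverse) V := fun y hy ↦ by
    obtain ⟨e, he⟩ := hinv y hy
    have h2 : ContinuousAt ContinuousLinearMap.inverse (g y) := by
      rw [← he]; exact (contDiffAt_map_inverse (n := 1) e).continuousAt
    exact h2.comp_continuousWithinAt (hg.continuousOn y hy)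
  have hflip : ∀ {F G H : Type _} [NormedAddCommGroup F] [NormedSpace ℝ F]
      [NormedAddCommGroup G] [NormedSpace ℝ G] [NormedAddCommGroup H] [NormedSpace ℝ H],
      Continuous (ContinuousLinearMap.flip : (F →L[ℝ] G →L[ℝ] H) → G →L[ℝ] F →L[ℝ] H) :=
    fun {F G H} _ _ _ _ _ _ ↦ (ContinuousLinearMap.flipₗᵢ ℝ F G H).continuous
  have h3 : ContinuousOn (christoffelLower g) V := by
    have hT := hflip.comp_continuousOn hf
    exact ((hf.add hT).sub (continuousOn_const.clm_comp hT)).const_smul (2⁻¹ : ℝ)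
  exact ((ContinuousLinearMap.compL ℝ E (E →L[ℝ] ℝ) E).continuous.comp_continuousOn h1).clm_comp h3

/-- Solutions of a linear ODE on `[0, 1]` whose coefficients have norm at most `1 / 2`. -/
theorem exists_hasDerivWithinAt_linear [CompleteSpace E] {A : ℝ → E →L[ℝ] E}
    (hA : ContinuousOn A (Icc 0 1)) {K : ℝ} (hK : ∀ t ∈ Icc (0 : ℝ) 1, ‖A t‖ ≤ K)
    (hK2 : K ≤ 1 / 2) (x : E) :
    ∃ e : ℝ → E, e 0 = x ∧
      (∀ t ∈ Icc (0 : ℝ) 1, HasDerivWithinAt e (A t (e t)) (Icc 0 1) t) ∧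
      ‖e 1 - x‖ ≤ 2 * K * ‖x‖ := by
  have hK0 : 0 ≤ K := (norm_nonneg _).trans (hK 0 (by simp))
  -- On the ball of radius ‖x‖ about x the speed is at most (1/2)(2‖x‖) = ‖x‖, exactly what one unit
  -- of time allows.
  have hP : IsPicardLindelof (fun t y ↦ A t y) (⟨0, by simp⟩ : Icc (0 : ℝ) 1) x (‖x‖₊) 0 (‖x‖₊)
      K.toNNReal := by
    refine ⟨fun t ht ↦ ?_, fun y _ ↦ hA.clm_apply continuousOn_const, fun t ht y hy ↦ ?_, ?_⟩
    · refine ((A t).lipschitz.weaken ?_).lipschitzOnWith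
      rw [← NNReal.coe_le_coe, Real.coe_toNNReal K hK0]
      exact hK t ht
    · rw [Metric.mem_closedBall, dist_eq_norm, coe_nnnorm] at hy
      have h1 : ‖y‖ ≤ 2 * ‖x‖ := by
        have := norm_le_insert x y
        rw [norm_sub_rev] at this
        linarith
      calc ‖A t y‖ ≤ K * ‖y‖ := (A t).le_of_opNorm_le (hK t ht) y
        _ ≤ 1 / 2 * (2 * ‖x‖) := by gcongr
        _ = _ := by simp
    · simp
  obtain ⟨e, he0, he⟩ := hP.exists_eq_forall_mem_Icc_hasDerivWithinAt₀
  refine ⟨e, he0, he, ?_⟩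
  have hc : ContinuousOn e (Icc 0 1) := fun t ht ↦ (he t ht).continuousWithinAt
  obtain ⟨τ, hτ, hmax⟩ := isCompact_Icc.exists_isMaxOn ⟨0, by simp⟩ hc.norm
  have hb : ∀ t ∈ Icc (0 : ℝ) 1, ‖e t - e 0‖ ≤ K * ‖e τ‖ := fun t ht ↦ by
    have := norm_image_sub_le_of_norm_deriv_le_segment' he (C := K * ‖e τ‖)
      (fun s hs ↦ ?_) t ht
    · refine this.trans ?_
      have : 0 ≤ K * ‖e τ‖ := by positivity
      nlinarith [ht.2]
    · have hs' : s ∈ Icc (0 : ℝ) 1 := ⟨hs.1, hs.2.le⟩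
      refine ((A s).le_of_opNorm_le (hK s hs') _).trans ?_
      have := hmax hs'
      gcongr
      exact this
  have he0' : e 0 = x := he0
  rw [he0'] at hb
  -- At the time of largest norm, ‖e τ‖ ≤ ‖x‖ + K‖e τ‖ with K ≤ 1/2.
  have h1 : ‖e τ‖ ≤ 2 * ‖x‖ := by
    have h2 := hb τ hτ
    have h3 := norm_le_insert x (e τ)
    rw [norm_sub_rev] at h3
    nlinarith [norm_nonneg (e τ)]
  calc ‖e 1 - x‖ ≤ K * ‖e τ‖ := hb 1 (by simp)
    _ ≤ K * (2 * ‖x‖) := by gcongr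
    _ = _ := by ring

/-- Parallel transport along coordinate segments: a frame at `y₀` extends to a Lipschitz family of
frames near `y₀` with the same Gram matrix and the same value of a parallel form. -/
theorem exists_parallel_frame [CompleteSpace E] {p : ℕ} {g : E → E →L[ℝ] E →L[ℝ] ℝ}
    {α : E → E [⋀^Fin p]→L[ℝ] ℝ} {V : Set E} (hV : IsOpen V) (hg : ContDiffOn ℝ 1 g V)
    (hsymm : ∀ y ∈ V, ∀ u v, g y u v = g y v u) (hinv : ∀ y ∈ V, (g y).IsInvertible)
    (hα : ContDiffOn ℝ 1 α V)
    (hpar : ∀ y ∈ V, ∀ u v, fderiv ℝ α y u v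
      - derivationAction (α y) (christoffelOf g y u) v = 0)
    {y₀ : E} (hy₀ : y₀ ∈ V) (e₀ : Fin p → E) :
    ∃ ε : E → Fin p → E, ε y₀ = e₀ ∧
      (∃ C : ℝ, ∀ᶠ y in 𝓝 y₀, ∀ i, ‖ε y i - e₀ i‖ ≤ C * ‖y - y₀‖) ∧
      ∀ᶠ y in 𝓝 y₀, (∀ i j, g y (ε y i) (ε y j) = g y₀ (e₀ i) (e₀ j)) ∧ α y (ε y) = α y₀ e₀ := by
  classical
  have hΓ := continuousOn_christoffelOf hV hg hinv
  have hΓ0 : ContinuousAt (christoffelOf g) y₀ := hΓ.continuousAt (hV.mem_nhds hy₀)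
  set M := ‖christoffelOf g y₀‖ + 1 with hM
  have hMpos : 0 < M := by positivity
  obtain ⟨R, hR, hball⟩ := Metric.nhds_basis_ball.eventually_iff.mp
    ((hV.eventually_mem hy₀).and (hΓ0.norm.eventually (gt_mem_nhds (show _ < M by linarith))))
  have key : ∀ y ∈ Metric.ball y₀ R, M * ‖y - y₀‖ ≤ 1 / 2 → ∃ e : Fin p → E,
      (∀ i, ‖e i - e₀ i‖ ≤ 2 * (M * ‖y - y₀‖) * ‖e₀ i‖) ∧
      (∀ i j, g y (e i) (e j) = g y₀ (e₀ i) (e₀ j)) ∧ α y e = α y₀ e₀ := by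
    intro y hy hyM
    set v := y - y₀ with hv
    have hγ : ∀ t, HasDerivAt (fun t : ℝ ↦ y₀ + t • v) v t := fun t ↦ by
      simpa using ((hasDerivAt_id t).smul_const v).const_add y₀
    have hmem : ∀ t ∈ Icc (0 : ℝ) 1, y₀ + t • v ∈ Metric.ball y₀ R := fun t ht ↦ by
      have : ‖v‖ < R := by rwa [← dist_eq_norm]
      rw [Metric.mem_ball, dist_eq_norm, add_sub_cancel_left, norm_smul, Real.norm_eq_abs,
        abs_of_nonneg ht.1]
      nlinarith [ht.2, norm_nonneg v]
    -- The transport equation along the segment is e' = -Γ(v, e). Metric compatibility and the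
    -- parallelism of α then make the Gram matrix and α(e) constant in t.
    have hA : ContinuousOn (fun t : ℝ ↦ -christoffelOf g (y₀ + t • v) v) (Icc 0 1) := by
      refine ContinuousOn.neg (ContinuousOn.clm_apply ?_ continuousOn_const)
      exact hΓ.comp (fun t _ ↦ (hγ t).continuousAt.continuousWithinAt)
        fun t ht ↦ (hball (hmem t ht)).1
    have hAK : ∀ t ∈ Icc (0 : ℝ) 1, ‖-christoffelOf g (y₀ + t • v) v‖ ≤ M * ‖v‖ := fun t ht ↦ by
      rw [norm_neg]
      exact ContinuousLinearMap.le_of_opNorm_le _ (hball (hmem t ht)).2.le v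
    choose e he0 hed hen using fun i ↦ exists_hasDerivWithinAt_linear hA hAK hyM (e₀ i)
    have h1v : y₀ + (1 : ℝ) • v = y := by simp [hv]
    have h0v : y₀ + (0 : ℝ) • v = y₀ := by simp
    have hconst : ∀ f : ℝ → ℝ, (∀ t ∈ Icc (0 : ℝ) 1, HasDerivWithinAt f 0 (Icc 0 1) t) →
        f 1 = f 0 := fun f hf ↦ by
      have := norm_image_sub_le_of_norm_deriv_le_segment_01' hf (C := 0) (by simp)
      exact sub_eq_zero.mp (norm_le_zero_iff.mp this)
    refine ⟨fun i ↦ e i 1, hen, fun i j ↦ ?_, ?_⟩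
    · have := hconst (fun t ↦ g (y₀ + t • v) (e i t) (e j t)) fun t ht ↦ by
        have hyt := (hball (hmem t ht)).1
        have hgd := (hg.differentiableOn (by simp)).differentiableAt (hV.mem_nhds hyt)
        have h1 := (hgd.hasFDerivAt.comp_hasDerivAt t (hγ t)).hasDerivWithinAt (s := Icc 0 1)
        refine ((h1.clm_apply (hed i t ht)).clm_apply (hed j t ht)).congr_deriv ?_
        have := apply_christoffelOf_add hV hsymm hyt hgd (hinv _ hyt) v (e i t) (e j t)
        simp only [neg_apply, map_neg, add_apply, Function.comp_apply]
        linarith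
      simpa only [h1v, h0v, he0] using this
    · have := hconst (fun t ↦ α (y₀ + t • v) (fun i ↦ e i t)) fun t ht ↦ by
        have hyt := (hball (hmem t ht)).1
        have hαd := (hα.differentiableOn (by simp)).differentiableAt (hV.mem_nhds hyt)
        have h1 := (hαd.hasFDerivAt.comp_hasDerivAt t (hγ t)).hasDerivWithinAt (s := Icc 0 1)
        have h2 := h1.hasFDerivWithinAt.continuousAlternatingMap_apply
          (fun i ↦ (hed i t ht).hasFDerivWithinAt)
        refine (h2.hasDerivWithinAt).congr_deriv ?_
        have h3 := hpar _ hyt v (fun i ↦ e i t)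
        rw [derivationAction] at h3
        have hneg : ∀ i w, α (y₀ + t • v) (Function.update (fun i ↦ e i t) i (-w)) =
            -α (y₀ + t • v) (Function.update (fun i ↦ e i t) i w) := fun i w ↦
          (α (y₀ + t • v)).toAlternatingMap.map_update_neg (fun i ↦ e i t) i w
        simp only [Function.comp_apply, add_apply, ContinuousLinearMap.coe_comp,
          ContinuousLinearMap.toSpanSingleton_apply, one_smul, sum_apply,
          ContinuousAlternatingMap.apply_apply, ContinuousAlternatingMap.toContinuousLinearMap_apply,
          neg_apply, hneg, Finset.sum_neg_distrib]
        linarith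
      simpa only [h1v, h0v, he0] using this
  choose! e he1 he2 he3 using key
  have hsmall : ∀ᶠ y in 𝓝 y₀, M * ‖y - y₀‖ < 1 / 2 := by
    have : ContinuousAt (fun y ↦ M * ‖y - y₀‖) y₀ := by fun_prop
    exact this.eventually (gt_mem_nhds (by simp))
  refine ⟨e, ?_, ⟨2 * M * ∑ i, ‖e₀ i‖, ?_⟩, ?_⟩
  · funext i
    have := he1 y₀ (Metric.mem_ball_self hR) (by simp) i
    simpa [sub_eq_zero] using this
  · filter_upwards [Metric.ball_mem_nhds y₀ hR, hsmall] with y h1 h2 i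
    refine (he1 y h1 h2.le i).trans ?_
    have := Finset.single_le_sum (f := fun i ↦ ‖e₀ i‖) (fun i _ ↦ norm_nonneg _)
      (Finset.mem_univ i)
    calc 2 * (M * ‖y - y₀‖) * ‖e₀ i‖ ≤ 2 * (M * ‖y - y₀‖) * ∑ i, ‖e₀ i‖ := by gcongr
      _ = _ := by ring
  · filter_upwards [Metric.ball_mem_nhds y₀ hR, hsmall] with y h1 h2
    exact ⟨he2 y h1 h2.le, he3 y h1 h2.le⟩

end Transport

/-! ### The metric in a chart: positivity, invertibility, regularity. -/

section Chart

variable {E : Type*} [NormedAddCommGroup E] [NormedSpace ℝ E]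
  {X : Type*} [EMetricSpace X] [ChartedSpace E X] [IsManifold 𝓘(ℝ, E) ∞ X]

theorem mfderiv_extChartAt_mfderiv_symm {c : X} {y : E}
    (hy : y ∈ (extChartAt 𝓘(ℝ, E) c).target) (u : E) :
    mfderiv 𝓘(ℝ, E) 𝓘(ℝ, E) (extChartAt 𝓘(ℝ, E) c) ((extChartAt 𝓘(ℝ, E) c).symm y)
      (mfderiv 𝓘(ℝ, E) 𝓘(ℝ, E) (extChartAt 𝓘(ℝ, E) c).symm y u) = u := by
  have := mfderiv_extChartAt_comp_mfderivWithin_extChartAt_symm hy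
  simp only [modelWithCornersSelf_coe, range_id, mfderivWithin_univ] at this
  exact congrArg (fun T : E →L[ℝ] E ↦ T u) this

theorem mfderiv_symm_mfderiv_extChartAt {c x : X} (hx : x ∈ (extChartAt 𝓘(ℝ, E) c).source)
    (v : TangentSpace 𝓘(ℝ, E) x) :
    mfderiv 𝓘(ℝ, E) 𝓘(ℝ, E) (extChartAt 𝓘(ℝ, E) c).symm (extChartAt 𝓘(ℝ, E) c x)
      (mfderiv 𝓘(ℝ, E) 𝓘(ℝ, E) (extChartAt 𝓘(ℝ, E) c) x v) = v := by
  have := mfderivWithin_extChartAt_symm_comp_mfderiv_extChartAt' hx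
  simp only [modelWithCornersSelf_coe, range_id, mfderivWithin_univ] at this
  exact congrArg (fun T : E →L[ℝ] E ↦ T v) this

variable [RiemannianBundle (fun x : X ↦ TangentSpace 𝓘(ℝ, E) x)]

theorem chartMetric_apply (c : X) (y u w : E) :
    chartMetric c y u w =
      inner ℝ (mfderiv 𝓘(ℝ, E) 𝓘(ℝ, E) (extChartAt 𝓘(ℝ, E) c).symm y u)
        (mfderiv 𝓘(ℝ, E) 𝓘(ℝ, E) (extChartAt 𝓘(ℝ, E) c).symm y w) :=
  rfl

theorem chartMetric_symm (c : X) (y u w : E) : chartMetric c y u w = chartMetric c y w u := by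
  rw [chartMetric_apply, chartMetric_apply, real_inner_comm]

theorem chartMetric_self (c : X) (y u : E) :
    chartMetric c y u u =
      ‖mfderiv 𝓘(ℝ, E) 𝓘(ℝ, E) (extChartAt 𝓘(ℝ, E) c).symm y u‖ ^ 2 := by
  rw [chartMetric_apply, real_inner_self_eq_norm_sq]

theorem chartMetric_extChartAt {c x : X} (hx : x ∈ (extChartAt 𝓘(ℝ, E) c).source)
    (v w : TangentSpace 𝓘(ℝ, E) x) :
    chartMetric c (extChartAt 𝓘(ℝ, E) c x)
      (mfderiv 𝓘(ℝ, E) 𝓘(ℝ, E) (extChartAt 𝓘(ℝ, E) c) x v)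
      (mfderiv 𝓘(ℝ, E) 𝓘(ℝ, E) (extChartAt 𝓘(ℝ, E) c) x w) = inner ℝ v w := by
  refine (chartMetric_apply c _ _ _).trans ?_
  -- The base point returned by the inverse chart equals `x` only propositionally. Vectors over
  -- different base points are compared in the common model `E`, and the base point is generalized
  -- before substitution.
  have h : ∀ z, z = x → ∀ a b : TangentSpace 𝓘(ℝ, E) z, @Eq E a v → @Eq E b w →
      inner ℝ a b = inner ℝ v w := by
    intro z hz a b ha hb
    subst hz
    cases ha
    cases hb
    rfl
  exact h _ ((extChartAt 𝓘(ℝ, E) c).left_inv hx) _ _ (mfderiv_symm_mfderiv_extChartAt hx v)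
    (mfderiv_symm_mfderiv_extChartAt hx w)

theorem chartMetric_pos {c : X} {y : E} (hy : y ∈ (extChartAt 𝓘(ℝ, E) c).target) {u : E}
    (hu : u ≠ 0) : 0 < chartMetric c y u u := by
  rw [chartMetric_apply]
  refine real_inner_self_pos.mpr fun h ↦ hu ?_
  have := mfderiv_extChartAt_mfderiv_symm hy u
  rw [h, map_zero] at this
  exact this.symm

variable [FiniteDimensional ℝ E]

theorem isInvertible_of_pos {B : E →L[ℝ] E →L[ℝ] ℝ} (hB : ∀ u, u ≠ 0 → 0 < B u u) :
    B.IsInvertible := by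
  have hinj : Function.Injective B.toLinearMap := by
    rw [← LinearMap.ker_eq_bot, LinearMap.ker_eq_bot']
    intro u hu
    by_contra h
    have h1 : B u = 0 := hu
    have := hB u h
    simp [h1] at this
  have hdim : Module.finrank ℝ E = Module.finrank ℝ (E →L[ℝ] ℝ) := by
    rw [← (LinearMap.toContinuousLinearMap (𝕜 := ℝ) (E := E) (F' := ℝ)).finrank_eq]
    exact (Subspace.dual_finrank_eq (K := ℝ) (V := E)).symm
  refine ⟨(LinearEquiv.ofInjectiveOfFinrankEq B.toLinearMap hinj hdim).toContinuousLinearEquiv, ?_⟩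
  ext u w
  rfl

theorem exists_pos_mul_norm_sq_le {B : E →L[ℝ] E →L[ℝ] ℝ} (hB : ∀ u, u ≠ 0 → 0 < B u u) :
    ∃ c > 0, ∀ u, c * ‖u‖ ^ 2 ≤ B u u := by
  rcases subsingleton_or_nontrivial E with h | h
  · exact ⟨1, one_pos, fun u ↦ by simp [Subsingleton.elim u 0]⟩
  have hc : Continuous fun u : E ↦ B u u := by fun_prop
  obtain ⟨z, hz, hmin⟩ := (isCompact_sphere (0 : E) 1).exists_isMinOn
    (NormedSpace.sphere_nonempty.mpr zero_le_one) hc.continuousOn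
  have hz0 : z ≠ 0 := ne_zero_of_mem_unit_sphere ⟨z, hz⟩
  refine ⟨B z z, hB z hz0, fun u ↦ ?_⟩
  rcases eq_or_ne u 0 with rfl | hu
  · simp
  have hu' : 0 < ‖u‖ := norm_pos_iff.mpr hu
  have h1 : ‖u‖⁻¹ • u ∈ Metric.sphere (0 : E) 1 := by
    simp [norm_smul, hu'.ne']
  have h2 : B z z ≤ B (‖u‖⁻¹ • u) (‖u‖⁻¹ • u) := hmin h1
  simp only [map_smul, FunLike.coe_smul, Pi.smul_apply, smul_eq_mul] at h2
  calc B z z * ‖u‖ ^ 2 ≤ ‖u‖⁻¹ * (‖u‖⁻¹ * B u u) * ‖u‖ ^ 2 := by gcongr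
    _ = B u u := by field_simp

variable [IsContMDiffRiemannianBundle 𝓘(ℝ, E) ∞ E (fun x : X ↦ TangentSpace 𝓘(ℝ, E) x)]

/-- Each coefficient is the inner product of two coordinate vector fields, which are C¹ as images of
constant fields under the tangent map of the inverse chart. -/
theorem contDiffOn_chartMetric (c : X) :
    ContDiffOn ℝ 1 (chartMetric (E := E) c) (extChartAt 𝓘(ℝ, E) c).target := by
  have hsec : ∀ u : E, ContMDiffOn 𝓘(ℝ, E) (𝓘(ℝ, E).prod 𝓘(ℝ, E)) 1
      (fun y : E ↦ (⟨(extChartAt 𝓘(ℝ, E) c).symm y,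
        mfderiv 𝓘(ℝ, E) 𝓘(ℝ, E) (extChartAt 𝓘(ℝ, E) c).symm y u⟩ :
          TotalSpace E (TangentSpace 𝓘(ℝ, E) : X → Type _)))
      (extChartAt 𝓘(ℝ, E) c).target := by
    intro u
    have h1 : ContMDiffOn 𝓘(ℝ, E) 𝓘(ℝ, E) ∞ (extChartAt 𝓘(ℝ, E) c).symm
        (extChartAt 𝓘(ℝ, E) c).target := contMDiffOn_extChartAt_symm c
    have h2 := h1.contMDiffOn_tangentMapWithin (m := 1) (by norm_cast)
      (isOpen_extChartAt_target c).uniqueMDiffOn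
    have h3 : ContMDiff 𝓘(ℝ, E) 𝓘(ℝ, E).tangent 1
        (fun y : E ↦ (⟨y, u⟩ : TangentBundle 𝓘(ℝ, E) E)) := fun y ↦
      contMDiffAt_vectorSpace_iff_contDiffAt (V := fun _ ↦ u).mpr contDiffAt_const
    refine (h2.comp h3.contMDiffOn (fun y hy ↦ hy)).congr fun y hy ↦ ?_
    simp only [Function.comp_apply, tangentMapWithin]
    rw [mfderivWithin_of_isOpen (isOpen_extChartAt_target c) hy]
  refine contDiffOn_clm_apply.mpr fun u ↦ contDiffOn_clm_apply.mpr fun w ↦ ?_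
  rw [← contMDiffOn_iff_contDiffOn]
  have := ContMDiffOn.inner_bundle (IB := 𝓘(ℝ, E)) (n := 1) (F := E)
    (E := fun x : X ↦ TangentSpace 𝓘(ℝ, E) x)
    (v := fun y ↦ mfderiv 𝓘(ℝ, E) 𝓘(ℝ, E) (extChartAt 𝓘(ℝ, E) c).symm y u)
    (w := fun y ↦ mfderiv 𝓘(ℝ, E) 𝓘(ℝ, E) (extChartAt 𝓘(ℝ, E) c).symm y w) (hsec u) (hsec w)
  exact this

end Chart

/-! ### Riemannian distance: Lipschitz bounds and lengths of coordinate segments. -/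

section Distance

open MeasureTheory

variable {E : Type*} [NormedAddCommGroup E] [NormedSpace ℝ E]
  {X : Type*} [EMetricSpace X] [ChartedSpace E X] [IsManifold 𝓘(ℝ, E) ∞ X]
  [RiemannianBundle (fun x : X ↦ TangentSpace 𝓘(ℝ, E) x)] [IsRiemannianManifold 𝓘(ℝ, E) X]

/-- A function with differential bounded by `C` near `x₀` is `C`-Lipschitz near `x₀`. -/
theorem exists_nhds_ofReal_abs_sub_le {f : X → ℝ} {x₀ : X} {C : ℝ}
    (h : ∀ᶠ x in 𝓝 x₀, ContMDiffAt 𝓘(ℝ, E) 𝓘(ℝ, ℝ) 1 f x ∧ ∀ v : TangentSpace 𝓘(ℝ, E) x,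
      abs (α := ℝ) (mfderiv 𝓘(ℝ, E) 𝓘(ℝ, ℝ) f x v) ≤ C * ‖v‖) :
    ∃ W ∈ 𝓝 x₀, ∀ y ∈ W, ∀ z ∈ W,
      ENNReal.ofReal |f z - f y| ≤ ENNReal.ofReal C * edist y z := by
  obtain ⟨r, hr, hball⟩ := EMetric.mem_nhds_iff.mp h
  refine ⟨Metric.eball x₀ (r / 2 / 2), Metric.eball_mem_nhds _ (by
    simp only [ENNReal.div_pos_iff]; simp [hr.ne']), fun y hy z hz ↦ ?_⟩
  have hyz : edist y z < r / 2 := by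
    calc edist y z ≤ edist y x₀ + edist z x₀ := edist_triangle_right y z x₀
      _ < r / 2 / 2 + r / 2 / 2 := ENNReal.add_lt_add hy hz
      _ = r / 2 := ENNReal.add_halves _
  -- The distance is an infimum that need not be attained, so it is approximated from above by
  -- lengths of curves.
  refine ENNReal.le_mul_of_forall_lt (.inr hyz.ne_top) (.inl ENNReal.ofReal_ne_top)
    fun a ha b hb ↦ ?_
  have hlt : riemannianEDist 𝓘(ℝ, E) y z < min b (r / 2) := by
    rw [← IsRiemannianManifold.out (I := 𝓘(ℝ, E))]
    exact lt_min hb hyz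
  obtain ⟨γ, hγ0, hγ1, hγ, hlen⟩ := exists_lt_of_riemannianEDist_lt hlt
  -- A curve that starts within r/4 of `x₀` and is shorter than r/2 cannot leave the r-ball where
  -- the differential is bounded.
  have hmem : ∀ t ∈ Icc (0 : ℝ) 1, γ t ∈ Metric.eball x₀ r := fun t ht ↦ by
    have h1 : edist y (γ t) < r / 2 := by
      rw [IsRiemannianManifold.out (I := 𝓘(ℝ, E)) y (γ t)]
      calc riemannianEDist 𝓘(ℝ, E) y (γ t) ≤ pathELength 𝓘(ℝ, E) γ 0 t :=
            riemannianEDist_le_pathELength (hγ.mono (Icc_subset_Icc_right ht.2)) hγ0 rfl ht.1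
        _ ≤ pathELength 𝓘(ℝ, E) γ 0 1 := pathELength_mono le_rfl ht.2
        _ < r / 2 := hlen.trans_le (min_le_right _ _)
    calc edist (γ t) x₀ ≤ edist y (γ t) + edist y x₀ := by
          rw [edist_comm y (γ t)]; exact edist_triangle _ _ _
      _ < r / 2 + r / 2 / 2 := ENNReal.add_lt_add h1 hy
      _ ≤ r / 2 + r / 2 := by gcongr; exact ENNReal.half_le_self
      _ = r := ENNReal.add_halves _
  have hfγ : ContDiffOn ℝ 1 (f ∘ γ) (Icc 0 1) := by
    rw [← contMDiffOn_iff_contDiffOn]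
    exact fun t ht ↦ (hball (hmem t ht)).1.comp_contMDiffWithinAt t (hγ t ht)
  calc ENNReal.ofReal |f z - f y| = ‖(f ∘ γ) 1 - (f ∘ γ) 0‖ₑ := by
        rw [Real.enorm_eq_ofReal_abs, Function.comp_apply, Function.comp_apply, hγ0, hγ1]
    _ ≤ ∫⁻ t in Icc 0 1, ‖derivWithin (f ∘ γ) (Icc 0 1) t‖ₑ :=
        enorm_sub_le_lintegral_derivWithin_Icc_of_contDiffOn_Icc hfγ zero_le_one
    _ ≤ ∫⁻ t in Icc (0 : ℝ) 1, ENNReal.ofReal C *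
          ‖mfderivWithin 𝓘(ℝ, ℝ) 𝓘(ℝ, E) γ (Icc 0 1) t 1‖ₑ := by
        refine setLIntegral_mono' measurableSet_Icc fun t ht ↦ ?_
        have h1 : mfderivWithin 𝓘(ℝ, ℝ) 𝓘(ℝ, ℝ) (f ∘ γ) (Icc 0 1) t =
            (mfderiv 𝓘(ℝ, E) 𝓘(ℝ, ℝ) f (γ t)).comp
              (mfderivWithin 𝓘(ℝ, ℝ) 𝓘(ℝ, E) γ (Icc 0 1) t) := by
          refine mfderiv_comp_mfderivWithin t ((hball (hmem t ht)).1.mdifferentiableAt one_ne_zero)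
            (hγ.mdifferentiableOn one_ne_zero t ht) ?_
          rw [uniqueMDiffWithinAt_iff_uniqueDiffWithinAt]
          exact uniqueDiffOn_Icc zero_lt_one t ht
        have h2 : derivWithin (f ∘ γ) (Icc 0 1) t =
            mfderiv 𝓘(ℝ, E) 𝓘(ℝ, ℝ) f (γ t)
              (mfderivWithin 𝓘(ℝ, ℝ) 𝓘(ℝ, E) γ (Icc 0 1) t 1) := by
          rw [← fderivWithin_derivWithin, ← mfderivWithin_eq_fderivWithin]
          exact congrArg (fun T : ℝ →L[ℝ] ℝ ↦ T 1) h1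
        rw [Real.enorm_eq_ofReal_abs]
        refine (ENNReal.ofReal_le_ofReal
          ((congrArg abs h2).trans_le ((hball (hmem t ht)).2 _))).trans ?_
        rw [ENNReal.ofReal_mul' (norm_nonneg _), ofReal_norm]
    _ = ENNReal.ofReal C * pathELength 𝓘(ℝ, E) γ 0 1 := by
        rw [lintegral_const_mul' _ _ ENNReal.ofReal_ne_top,
          pathELength_eq_lintegral_mfderivWithin_Icc]
    _ ≤ a * b := mul_le_mul' ha.le (hlen.le.trans (min_le_left _ _))

/-- The length of a coordinate segment bounds the distance of its end points. -/
theorem edist_symm_add_smul_le {c : X} {y n : E} {τ C : ℝ} (hτ : 0 ≤ τ)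
    (hmem : ∀ t ∈ Icc 0 τ, y + t • n ∈ (extChartAt 𝓘(ℝ, E) c).target)
    (hC : ∀ t ∈ Icc 0 τ, chartMetric c (y + t • n) n n ≤ C ^ 2) (hC0 : 0 ≤ C) :
    edist ((extChartAt 𝓘(ℝ, E) c).symm y) ((extChartAt 𝓘(ℝ, E) c).symm (y + τ • n)) ≤
      ENNReal.ofReal (C * τ) := by
  set γ : ℝ → X := (extChartAt 𝓘(ℝ, E) c).symm ∘ fun t : ℝ ↦ y + t • n with hγ
  have hl : ContMDiff 𝓘(ℝ, ℝ) 𝓘(ℝ, E) 1 fun t : ℝ ↦ y + t • n := by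
    rw [contMDiff_iff_contDiff]; fun_prop
  have hsm : ContMDiffOn 𝓘(ℝ, E) 𝓘(ℝ, E) 1 (extChartAt 𝓘(ℝ, E) c).symm
      (extChartAt 𝓘(ℝ, E) c).target := (contMDiffOn_extChartAt_symm (n := ∞) c).of_le (by norm_cast)
  rw [IsRiemannianManifold.out (I := 𝓘(ℝ, E)) (M := X)]
  calc _ ≤ pathELength 𝓘(ℝ, E) γ 0 τ :=
        riemannianEDist_le_pathELength (hsm.comp hl.contMDiffOn hmem) (by simp [hγ]) rfl hτ
    _ = ∫⁻ t in Icc 0 τ, ‖mfderiv 𝓘(ℝ, ℝ) 𝓘(ℝ, E) γ t 1‖ₑ :=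
        pathELength_eq_lintegral_mfderiv_Icc
    _ ≤ ∫⁻ t in Icc 0 τ, ENNReal.ofReal C := by
        refine setLIntegral_mono' measurableSet_Icc fun t ht ↦ ?_
        have h1 : mfderiv 𝓘(ℝ, ℝ) 𝓘(ℝ, E) γ t =
            (mfderiv 𝓘(ℝ, E) 𝓘(ℝ, E) (extChartAt 𝓘(ℝ, E) c).symm (y + t • n)).comp
              (mfderiv 𝓘(ℝ, ℝ) 𝓘(ℝ, E) (fun t : ℝ ↦ y + t • n) t) :=
          mfderiv_comp t
            ((hsm.contMDiffAt ((isOpen_extChartAt_target c).mem_nhds (hmem t ht))).mdifferentiableAt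
              one_ne_zero) (hl.mdifferentiable one_ne_zero t)
        have h2 : mfderiv 𝓘(ℝ, ℝ) 𝓘(ℝ, E) (fun t : ℝ ↦ y + t • n) t (1 : ℝ) = n := by
          have : HasDerivAt (fun t : ℝ ↦ y + t • n) n t := by
            simpa using ((hasDerivAt_id t).smul_const n).const_add y
          rw [mfderiv_eq_fderiv]
          exact this.deriv
        have h3 : mfderiv 𝓘(ℝ, ℝ) 𝓘(ℝ, E) γ t (1 : ℝ) =
            mfderiv 𝓘(ℝ, E) 𝓘(ℝ, E) (extChartAt 𝓘(ℝ, E) c).symm (y + t • n) n := by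
          rw [h1]
          exact congrArg (mfderiv 𝓘(ℝ, E) 𝓘(ℝ, E) (extChartAt 𝓘(ℝ, E) c).symm (y + t • n)) h2
        have h4 := hC t ht
        rw [chartMetric_self] at h4
        have h5 : ‖mfderiv 𝓘(ℝ, ℝ) 𝓘(ℝ, E) γ t (1 : ℝ)‖ ≤ C := by
          rw [h3]
          exact le_of_sq_le_sq h4 hC0
        rw [← ofReal_norm]
        exact ENNReal.ofReal_le_ofReal h5
    _ = ENNReal.ofReal (C * τ) := by
        rw [setLIntegral_const, Real.volume_Icc, sub_zero, ENNReal.ofReal_mul hC0]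

end Distance

/-! ### The first cousin principle for forms of comass one. -/

section FirstCousin

variable {V : Type*} [NormedAddCommGroup V] [InnerProductSpace ℝ V] {p : ℕ}

/-- The first cousin principle: a form of comass one vanishes on the first cousins of a plane on
which it is maximal. -/
theorem map_update_eq_zero_of_forall_inner_eq_zero {f : V [⋀^Fin p]→ₗ[ℝ] ℝ}
    (hf : ∀ e : Fin p → V, Orthonormal ℝ e → f e ≤ 1) {e : Fin p → V} (he : Orthonormal ℝ e)
    (hfe : f e = 1) (i : Fin p) {n : V} (hn : ∀ j, inner ℝ (e j) n = 0) :
    f (Function.update e i n) = 0 := by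
  rcases eq_or_ne n 0 with rfl | hn0
  · exact f.map_coord_zero i (by simp)
  set m := ‖n‖⁻¹ • n with hm
  have hnn : ‖n‖ ≠ 0 := norm_ne_zero_iff.mpr hn0
  have hm1 : ‖m‖ = 1 := by simp [hm, norm_smul, hnn]
  have hme : ∀ j, inner ℝ (e j) m = 0 := fun j ↦ by rw [hm, inner_smul_right, hn j, mul_zero]
  have hnm : n = ‖n‖ • m := by rw [hm, smul_smul, mul_inv_cancel₀ hnn, one_smul]
  rw [hnm, AlternatingMap.map_update_smul]
  set l := f (Function.update e i m) with hl
  -- Rotating eᵢ towards the unit normal m keeps the frame orthonormal. The optimal angle, (a, b)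
  -- proportional to (1, l), gives √(1 + l²) ≤ 1, hence l = 0.
  have key : ∀ a b : ℝ, a ^ 2 + b ^ 2 = 1 → a + b * l ≤ 1 := by
    intro a b hab
    have h1 : Orthonormal ℝ (Function.update e i (a • e i + b • m)) := by
      rw [orthonormal_iff_ite] at he ⊢
      intro j k
      have hmm : inner ℝ m m = (1 : ℝ) := by rw [real_inner_self_eq_norm_sq, hm1]; norm_num
      have hme' : ∀ j, inner ℝ m (e j) = 0 := fun j ↦ by rw [real_inner_comm]; exact hme j
      rcases eq_or_ne j i with rfl | hj <;> rcases eq_or_ne k j with rfl | hk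
      · simp only [Function.update_self, inner_add_left, inner_add_right, inner_smul_left,
          inner_smul_right, he, hme, hme', hmm]
        simp
        nlinarith
      · simp [Function.update_of_ne hk, inner_add_left, inner_smul_left, he, hme', hk.symm]
      · rw [Function.update_of_ne hj, he]
      · rcases eq_or_ne k i with rfl | hk'
        · simp [inner_add_right, inner_smul_right, he, hme, hj]
        · simp [Function.update_of_ne hj, Function.update_of_ne hk', he]
    have h2 := hf _ h1
    rw [AlternatingMap.map_update_add, AlternatingMap.map_update_smul,
      AlternatingMap.map_update_smul, Function.update_eq_self, hfe] at h2
    simpa using h2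
  have hs : 0 < Real.sqrt (1 + l ^ 2) := Real.sqrt_pos.mpr (by positivity)
  have hsq : Real.sqrt (1 + l ^ 2) ^ 2 = 1 + l ^ 2 := Real.sq_sqrt (by positivity)
  have h3 := key (1 / Real.sqrt (1 + l ^ 2)) (l / Real.sqrt (1 + l ^ 2)) (by
    rw [div_pow, div_pow, hsq]; field_simp)
  have h4 : 1 / Real.sqrt (1 + l ^ 2) + l / Real.sqrt (1 + l ^ 2) * l = Real.sqrt (1 + l ^ 2) := by
    field_simp
    rw [hsq]
  rw [h4] at h3
  have : l ^ 2 = 0 := by nlinarith [sq_nonneg l]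
  rw [pow_eq_zero_iff two_ne_zero] at this
  rw [this, smul_zero]

/-- The component of w normal to the plane contributes nothing by the first cousin principle, and
the components along eⱼ with j ≠ i repeat a vector, so only the eᵢ component survives. -/
theorem map_update_eq_inner {f : V [⋀^Fin p]→ₗ[ℝ] ℝ}
    (hf : ∀ e : Fin p → V, Orthonormal ℝ e → f e ≤ 1) {e : Fin p → V} (he : Orthonormal ℝ e)
    (hfe : f e = 1) (i : Fin p) (w : V) : f (Function.update e i w) = inner ℝ (e i) w := by
  have he' := orthonormal_iff_ite.mp he
  have h1 := map_update_eq_zero_of_forall_inner_eq_zero hf he hfe i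
    (n := w - ∑ j, inner ℝ (e j) w • e j) fun j ↦ by
      simp [inner_sub_right, inner_sum, inner_smul_right, he']
  rw [AlternatingMap.map_update_sub, sub_eq_zero] at h1
  rw [h1, AlternatingMap.map_update_sum]
  rw [Finset.sum_eq_single i]
  · rw [AlternatingMap.map_update_smul, Function.update_eq_self, hfe, smul_eq_mul, mul_one]
  · intro j _ hj
    rw [AlternatingMap.map_update_smul, f.map_update_self e hj.symm, smul_zero]
  · simp

end FirstCousin

/-! ### The φ-Hessian as a trace. -/

section PhiHessian

variable {E : Type*} [NormedAddCommGroup E] [NormedSpace ℝ E] [FiniteDimensional ℝ E]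
  {X : Type*} [EMetricSpace X] [ChartedSpace E X]
  [RiemannianBundle (fun x : X ↦ TangentSpace 𝓘(ℝ, E) x)] {p : ℕ}

theorem inner_hessian (c : X) (f : X → ℝ) (x : X) (v w : TangentSpace 𝓘(ℝ, E) x) :
    inner ℝ (hessian c f x v) w = hessianForm c f x v w := by
  have : FiniteDimensional ℝ (TangentSpace 𝓘(ℝ, E) x) := inferInstanceAs (FiniteDimensional ℝ E)
  have hinv : (metricAt x :
      TangentSpace 𝓘(ℝ, E) x →L[ℝ] TangentSpace 𝓘(ℝ, E) x →L[ℝ] ℝ).IsInvertible :=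
    isInvertible_of_pos (E := TangentSpace 𝓘(ℝ, E) x) fun u hu ↦ real_inner_self_pos.mpr hu
  have h1 : metricAt x ((metricAt x).inverse (hessianForm c f x v)) = hessianForm c f x v :=
    congrArg (fun T ↦ T (hessianForm c f x v)) hinv.self_comp_inverse
  exact congrArg (fun T : TangentSpace 𝓘(ℝ, E) x →L[ℝ] ℝ ↦ T w) h1

/-- On a `φ`-plane the `φ`-Hessian is the trace of the Hessian over the plane. -/
theorem phiHessian_eq_sum {φ : ∀ x : X, TangentSpace 𝓘(ℝ, E) x [⋀^Fin p]→L[ℝ] ℝ}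
    (hφ : IsCalibration φ) (c : X) (f : X → ℝ) {x : X} {e : Fin p → TangentSpace 𝓘(ℝ, E) x}
    (he : IsPhiPlane φ x e) :
    phiHessian φ c f x e =
      ∑ i, hessianOf (chartMetric c) (f ∘ (extChartAt 𝓘(ℝ, E) c).symm) (extChartAt 𝓘(ℝ, E) c x)
        (mfderiv 𝓘(ℝ, E) 𝓘(ℝ, E) (extChartAt 𝓘(ℝ, E) c) x (e i))
        (mfderiv 𝓘(ℝ, E) 𝓘(ℝ, E) (extChartAt 𝓘(ℝ, E) c) x (e i)) := by
  rw [phiHessian, derivationAction]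
  refine Finset.sum_congr rfl fun i _ ↦ ?_
  have h1 : φ x (Function.update e i (hessian c f x (e i))) =
      inner ℝ (e i) (hessian c f x (e i)) :=
    map_update_eq_inner (V := TangentSpace 𝓘(ℝ, E) x) (p := p)
      (f := (φ x).toAlternatingMap) (hφ.comass_le_one x) he.1 he.2 i _
  rw [h1, real_inner_comm, inner_hessian]
  rfl

end PhiHessian

/-! ### Comparing a boundary-vanishing function with the distance to the boundary. -/

section Estimates

/-- A locally Lipschitz function that vanishes on the boundary is dominated by the distance to
the boundary. -/
theorem eventually_abs_le_mul_boundaryDist {Y : Type*} [EMetricSpace Y] {Ω : Set Y} {f : Y → ℝ}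
    {x : Y} {C : ℝ} (hC : 0 < C) (hx : x ∈ frontier Ω) (hf0 : ∀ z ∈ frontier Ω, f z = 0)
    (hfc : ContinuousAt f x)
    (hf : ∃ W ∈ 𝓝 x, ∀ y ∈ W, ∀ z ∈ W,
      ENNReal.ofReal |f z - f y| ≤ ENNReal.ofReal C * edist y z) :
    ∀ᶠ y in 𝓝 x, |f y| ≤ C * boundaryDist Ω y := by
  obtain ⟨W, hW, hLip⟩ := hf
  obtain ⟨r, hr, hball⟩ := EMetric.mem_nhds_iff.mp hW
  have hr2 : 0 < min (r / 2) 1 := lt_min (ENNReal.half_pos hr.ne') one_pos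
  have hlim : Filter.Tendsto (fun y ↦ ENNReal.ofReal |f y|) (𝓝 x) (𝓝 0) := by
    have h1 := hfc.abs.tendsto
    rw [hf0 x hx, abs_zero] at h1
    simpa using ENNReal.tendsto_ofReal h1
  have hCr : 0 < ENNReal.ofReal C * (r / 2) :=
    ENNReal.mul_pos (by simpa using hC) (ENNReal.half_pos hr.ne').ne'
  filter_upwards [hW, Metric.eball_mem_nhds x hr2, hlim.eventually (gt_mem_nhds hCr)]
    with y hyW hyr hys
  have hyr' : edist y x < min (r / 2) 1 := hyr
  have hfin : Metric.infEDist y (frontier Ω) ≠ ⊤ :=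
    ((Metric.infEDist_le_edist_of_mem hx).trans_lt
      ((hyr'.trans_le (min_le_right _ _)).trans ENNReal.one_lt_top)).ne
  have key : ENNReal.ofReal |f y| / ENNReal.ofReal C ≤ Metric.infEDist y (frontier Ω) := by
    refine Metric.le_infEDist.mpr fun z hz ↦ ?_
    rw [ENNReal.div_le_iff_le_mul (.inl (by simpa using hC)) (.inl ENNReal.ofReal_ne_top), mul_comm]
    by_cases hzW : z ∈ W
    · have := hLip y hyW z hzW
      rwa [hf0 z hz, zero_sub, abs_neg] at this
    -- Boundary points outside W are at distance at least r/2 from y, while |f y| is already below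
    -- C·r/2 by continuity.
    · refine hys.le.trans ?_
      gcongr
      by_contra! hlt
      refine hzW (hball ?_)
      calc edist z x ≤ edist y z + edist y x := by
            rw [edist_comm y z]; exact edist_triangle _ _ _
        _ < r / 2 + r / 2 := ENNReal.add_lt_add hlt (hyr'.trans_le (min_le_left _ _))
        _ = r := ENNReal.add_halves _
  have h2 := ENNReal.toReal_mono hfin key
  rw [ENNReal.toReal_div, ENNReal.toReal_ofReal (abs_nonneg _), ENNReal.toReal_ofReal hC.le,
    div_le_iff₀ hC] at h2
  rw [mul_comm]
  exact h2

variable {E : Type*} [NormedAddCommGroup E] [NormedSpace ℝ E]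

/-- The form κg - ds ⊗ ds is at least (κ - 1)c|u|² at `y₀`, and a perturbation smaller than (κ - 1)c
in operator norm leaves it nonnegative for all u at once. -/
theorem eventually_sq_fderiv_le {g : E → E →L[ℝ] E →L[ℝ] ℝ} {s : E → ℝ} {y₀ : E} {c κ : ℝ}
    (hg : ContinuousAt g y₀) (hs : ContinuousAt (fderiv ℝ s) y₀) (hc : 0 < c)
    (hgc : ∀ u, c * ‖u‖ ^ 2 ≤ g y₀ u u) (hsg : ∀ u, (fderiv ℝ s y₀ u) ^ 2 ≤ g y₀ u u)
    (hκ : 1 < κ) : ∀ᶠ y in 𝓝 y₀, ∀ u, (fderiv ℝ s y u) ^ 2 ≤ κ * g y u u := by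
  set T : E → E →L[ℝ] E →L[ℝ] ℝ := fun y ↦
    κ • g y - (ContinuousLinearMap.smulRightL ℝ E (E →L[ℝ] ℝ) (fderiv ℝ s y)) (fderiv ℝ s y)
    with hT
  have hTc : ContinuousAt T y₀ := by
    refine (hg.const_smul κ).sub (ContinuousAt.clm_apply ?_ hs)
    exact (ContinuousLinearMap.smulRightL ℝ E (E →L[ℝ] ℝ)).continuous.continuousAt.comp hs
  have hTu : ∀ y u, T y u u = κ * g y u u - (fderiv ℝ s y u) ^ 2 := fun y u ↦ by
    simp [hT, pow_two]
  have hcκ : 0 < (κ - 1) * c := mul_pos (by linarith) hc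
  have hev : ∀ᶠ y in 𝓝 y₀, ‖T y - T y₀‖ < (κ - 1) * c := by
    have : ContinuousAt (fun y ↦ ‖T y - T y₀‖) y₀ := (hTc.sub continuousAt_const).norm
    exact this.eventually (gt_mem_nhds (by simpa using hcκ))
  filter_upwards [hev] with y hy u
  have h1 : ‖(T y - T y₀) u u‖ ≤ (κ - 1) * c * ‖u‖ ^ 2 := by
    calc ‖(T y - T y₀) u u‖ ≤ ‖T y - T y₀‖ * ‖u‖ * ‖u‖ := (T y - T y₀).le_opNorm₂ u u
      _ ≤ (κ - 1) * c * ‖u‖ * ‖u‖ := by gcongr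
      _ = _ := by ring
  have h2 : (κ - 1) * c * ‖u‖ ^ 2 ≤ T y₀ u u := by
    rw [hTu]
    nlinarith [hsg u, hgc u]
  have h3 := (abs_le.mp h1).1
  have h4 : (T y - T y₀) u u = T y u u - T y₀ u u := rfl
  rw [h4, hTu y u] at h3
  linarith

theorem hessianOf_const_mul (g : E → E →L[ℝ] E →L[ℝ] ℝ) {h : E → ℝ} {y : E}
    (hh : ContDiffAt ℝ 2 h y) (a : ℝ) (u v : E) :
    hessianOf g (fun z ↦ a * h z) y u v = a * hessianOf g h y u v := by
  have hev : fderiv ℝ (fun z ↦ a * h z) =ᶠ[𝓝 y] fun z ↦ a • fderiv ℝ h z := by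
    filter_upwards [hh.eventually (by simp)] with z hz
    exact fderiv_const_mul (hz.differentiableAt (by simp)) a
  have hd : DifferentiableAt ℝ (fderiv ℝ h) y :=
    (hh.fderiv_right (m := 1) (by norm_num)).differentiableAt (by simp)
  rw [hessianOf_apply, hessianOf_apply, hev.fderiv_eq, hev.self_of_nhds, fderiv_fun_const_smul hd]
  simp [mul_sub]

end Estimates

/-! ### Passing differentials, forms and φ-planes through a chart. -/

section Coordinates

variable {E : Type*} [NormedAddCommGroup E] [NormedSpace ℝ E]
  {X : Type*} [EMetricSpace X] [ChartedSpace E X] [IsManifold 𝓘(ℝ, E) ∞ X]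

theorem mfderiv_apply_eq_fderiv {f : X → ℝ} {c x : X} (hx : x ∈ (extChartAt 𝓘(ℝ, E) c).source)
    (hf : DifferentiableAt ℝ (f ∘ (extChartAt 𝓘(ℝ, E) c).symm) (extChartAt 𝓘(ℝ, E) c x))
    (v : TangentSpace 𝓘(ℝ, E) x) :
    mfderiv 𝓘(ℝ, E) 𝓘(ℝ, ℝ) f x v =
      fderiv ℝ (f ∘ (extChartAt 𝓘(ℝ, E) c).symm) (extChartAt 𝓘(ℝ, E) c x)
        (mfderiv 𝓘(ℝ, E) 𝓘(ℝ, E) (extChartAt 𝓘(ℝ, E) c) x v) := by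
  have h1 : f =ᶠ[𝓝 x] (f ∘ (extChartAt 𝓘(ℝ, E) c).symm) ∘ extChartAt 𝓘(ℝ, E) c := by
    filter_upwards [(isOpen_extChartAt_source c).mem_nhds hx] with z hz
    simp only [Function.comp_apply, (extChartAt 𝓘(ℝ, E) c).left_inv hz]
  have h2 : mfderiv 𝓘(ℝ, E) 𝓘(ℝ, ℝ)
      ((f ∘ (extChartAt 𝓘(ℝ, E) c).symm) ∘ extChartAt 𝓘(ℝ, E) c) x = _ :=
    mfderiv_comp x (I' := 𝓘(ℝ, E)) hf.mdifferentiableAt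
      (mdifferentiableAt_extChartAt (by simpa using hx))
  have h3 := h1.mfderiv_eq (I := 𝓘(ℝ, E)) (I' := 𝓘(ℝ, ℝ))
  have h4 : (mfderiv 𝓘(ℝ, E) 𝓘(ℝ, ℝ) f x : E →L[ℝ] ℝ) = _ := h3.trans h2
  rw [mfderiv_eq_fderiv] at h4
  exact congrArg (fun T : E →L[ℝ] ℝ ↦ T v) h4

theorem contDiffAt_comp_symm {f : X → ℝ} {S : Set X} (hS : IsOpen S)
    (hf : ContMDiffOn 𝓘(ℝ, E) 𝓘(ℝ, ℝ) ∞ f S) {c : X} {y : E}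
    (hy : y ∈ (extChartAt 𝓘(ℝ, E) c).target) (hyS : (extChartAt 𝓘(ℝ, E) c).symm y ∈ S) :
    ContDiffAt ℝ 2 (f ∘ (extChartAt 𝓘(ℝ, E) c).symm) y := by
  rw [← contMDiffAt_iff_contDiffAt]
  have h1 : ContMDiffAt 𝓘(ℝ, E) 𝓘(ℝ, E) ∞ (extChartAt 𝓘(ℝ, E) c).symm y :=
    (contMDiffOn_extChartAt_symm c).contMDiffAt ((isOpen_extChartAt_target c).mem_nhds hy)
  exact ((hf.contMDiffAt (hS.mem_nhds hyS)).comp y h1).of_le (by norm_cast)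

variable {p : ℕ}

theorem chartForm_extChartAt (φ : ∀ x : X, TangentSpace 𝓘(ℝ, E) x [⋀^Fin p]→L[ℝ] ℝ) {c x : X}
    (hx : x ∈ (extChartAt 𝓘(ℝ, E) c).source) (e : Fin p → TangentSpace 𝓘(ℝ, E) x) :
    chartForm φ c (extChartAt 𝓘(ℝ, E) c x)
      (fun i ↦ mfderiv 𝓘(ℝ, E) 𝓘(ℝ, E) (extChartAt 𝓘(ℝ, E) c) x (e i)) = φ x e := by
  have h : ∀ z, z = x → ∀ a : Fin p → TangentSpace 𝓘(ℝ, E) z, @Eq (Fin p → E) a e →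
      φ z a = φ x e := by
    intro z hz a ha
    subst hz
    cases ha
    rfl
  exact h _ ((extChartAt 𝓘(ℝ, E) c).left_inv hx) _
    (funext fun i ↦ mfderiv_symm_mfderiv_extChartAt hx (e i))

variable [RiemannianBundle (fun x : X ↦ TangentSpace 𝓘(ℝ, E) x)] [FiniteDimensional ℝ E]

theorem isPhiPlane_mfderiv_symm {φ : ∀ x : X, TangentSpace 𝓘(ℝ, E) x [⋀^Fin p]→L[ℝ] ℝ} {c : X}
    {y : E} {ε : Fin p → E}
    (horth : ∀ i j, chartMetric c y (ε i) (ε j) = if i = j then 1 else 0)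
    (hφ : chartForm φ c y ε = 1) :
    IsPhiPlane φ ((extChartAt 𝓘(ℝ, E) c).symm y)
      (fun i ↦ mfderiv 𝓘(ℝ, E) 𝓘(ℝ, E) (extChartAt 𝓘(ℝ, E) c).symm y (ε i)) :=
  ⟨orthonormal_iff_ite.mpr horth, hφ⟩

theorem phiHessian_symm_eq_sum {φ : ∀ x : X, TangentSpace 𝓘(ℝ, E) x [⋀^Fin p]→L[ℝ] ℝ}
    (hφ : IsCalibration φ) {c : X} {y : E} (hy : y ∈ (extChartAt 𝓘(ℝ, E) c).target) (f : X → ℝ)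
    {ε : Fin p → E}
    (horth : ∀ i j, chartMetric c y (ε i) (ε j) = if i = j then 1 else 0)
    (hφε : chartForm φ c y ε = 1) :
    phiHessian φ c f ((extChartAt 𝓘(ℝ, E) c).symm y)
      (fun i ↦ mfderiv 𝓘(ℝ, E) 𝓘(ℝ, E) (extChartAt 𝓘(ℝ, E) c).symm y (ε i)) =
      ∑ i, hessianOf (chartMetric c) (f ∘ (extChartAt 𝓘(ℝ, E) c).symm) y (ε i) (ε i) := by
  refine (phiHessian_eq_sum hφ c f (isPhiPlane_mfderiv_symm horth hφε)).trans
    (Finset.sum_congr rfl fun i _ ↦ ?_)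
  have h1 : hessianOf (chartMetric c) (f ∘ (extChartAt 𝓘(ℝ, E) c).symm)
      (extChartAt 𝓘(ℝ, E) c ((extChartAt 𝓘(ℝ, E) c).symm y)) =
      hessianOf (chartMetric c) (f ∘ (extChartAt 𝓘(ℝ, E) c).symm) y := by
    rw [(extChartAt 𝓘(ℝ, E) c).right_inv hy]
  exact congrArg₂ (fun (T : E →L[ℝ] E →L[ℝ] ℝ) (v : E) ↦ T v v) h1
    (mfderiv_extChartAt_mfderiv_symm hy (ε i))

end Coordinates

/-! ### The boundary argument. -/

/-- If `φ` is parallel and `-log dist(·, ∂Ω)` is strictly `φ`-plurisubharmonic near `∂Ω`, then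
`∂Ω` is `φ`-convex. -/
theorem hasPhiConvexBoundary_of_isStrictlyPhiPSHOn
    {E : Type*} [NormedAddCommGroup E] [NormedSpace ℝ E] [FiniteDimensional ℝ E]
    {X : Type*} [EMetricSpace X] [ChartedSpace E X] [IsManifold 𝓘(ℝ, E) ∞ X]
    [RiemannianBundle (fun x : X ↦ TangentSpace 𝓘(ℝ, E) x)]
    [IsContMDiffRiemannianBundle 𝓘(ℝ, E) ∞ E (fun x : X ↦ TangentSpace 𝓘(ℝ, E) x)]
    [IsRiemannianManifold 𝓘(ℝ, E) X]
    {p : ℕ} {φ : ∀ x : X, TangentSpace 𝓘(ℝ, E) x [⋀^Fin p]→L[ℝ] ℝ}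
    (hφ : IsCalibration φ) (hpar : IsParallel φ)
    {Ω : Set X} (hΩ : IsOpen Ω)
    (hsmooth : HasSmoothBoundary E Ω)
    (hpsh : ∃ U : Set X, IsOpen U ∧ frontier Ω ⊆ U ∧
      IsStrictlyPhiPSHOn φ
        (fun x ↦ -Real.log (boundaryDist Ω x)) (U ∩ Ω)) :
    HasPhiConvexBoundary φ Ω := by
  classical
  refine ⟨hsmooth, fun ρ hρ x hx c hxc e he htan ↦ ?_⟩
  by_contra! hneg
  obtain ⟨N, hN, hNcl, hρN, hΩρ, hdρ⟩ := hρ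
  obtain ⟨U, hU, hUfr, hfs, hpos⟩ := hpsh
  have hρ0 : ∀ z ∈ frontier Ω, ρ z = 0 := fun z hz ↦ by
    rw [hΩ.frontier_eq] at hz
    have hzN := hNcl hz.1
    refine le_antisymm ?_ ?_
    · by_contra! hlt
      have hc := (hρN.contMDiffAt (hN.mem_nhds hzN)).continuousAt
      obtain ⟨w, hw1, hw2⟩ := ((mem_closure_iff_frequently.mp hz.1).and_eventually
        (hc.eventually (lt_mem_nhds hlt))).exists
      rw [hΩρ] at hw1
      exact lt_asymm hw1.2 hw2
    · by_contra! hlt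
      exact hz.2 (by rw [hΩρ]; exact ⟨hzN, hlt⟩)
  have hxN : x ∈ N := hNcl (frontier_subset_closure hx)
  set ψ := extChartAt 𝓘(ℝ, E) c with hψ
  set y₀ : E := ψ x with hy₀
  have hy₀V : y₀ ∈ ψ.target := ψ.map_source hxc
  have hV : IsOpen ψ.target := isOpen_extChartAt_target c
  have hsx : ψ.symm y₀ = x := ψ.left_inv hxc
  have hsymmc : ContinuousAt ψ.symm y₀ := continuousAt_extChartAt_symm'' hy₀V
  have hpull : ∀ {P : X → Prop}, (∀ᶠ z in 𝓝 x, P z) → ∀ᶠ y in 𝓝 y₀, P (ψ.symm y) := fun hP ↦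
    hsymmc.tendsto.eventually (by rwa [hsx])
  set g := chartMetric (E := E) c with hg
  have hgV : ContDiffOn ℝ 1 g ψ.target := contDiffOn_chartMetric c
  have hginv : ∀ y ∈ ψ.target, (g y).IsInvertible := fun y hy ↦
    isInvertible_of_pos fun u hu ↦ chartMetric_pos hy hu
  have hgc : ContinuousAt g y₀ := hgV.continuousOn.continuousAt (hV.mem_nhds hy₀V)
  have hΓ : ContinuousAt (christoffelOf g) y₀ :=
    (continuousOn_christoffelOf hV hgV hginv).continuousAt (hV.mem_nhds hy₀V)
  obtain ⟨b, hb, hbg⟩ := exists_pos_mul_norm_sq_le (B := g y₀) fun u hu ↦ chartMetric_pos hy₀V hu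
  set h : E → ℝ := ρ ∘ ψ.symm with hh
  have hhd : ContDiffAt ℝ 2 h y₀ := contDiffAt_comp_symm hN hρN hy₀V (by rwa [hsx])
  have hhdd : DifferentiableAt ℝ h y₀ := hhd.differentiableAt (by simp)
  -- Here w is the gradient of ρ at `y₀` in coordinates. Dividing by its length a and reversing the
  -- sign gives s with unit gradient n, the inward normal.
  obtain ⟨w, hw⟩ : ∃ w, g y₀ w = fderiv ℝ h y₀ := by
    obtain ⟨T, hT⟩ := hginv y₀ hy₀V
    exact ⟨T.symm (fderiv ℝ h y₀), by rw [← hT]; exact T.apply_symm_apply _⟩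
  have hw0 : w ≠ 0 := by
    rintro rfl
    refine hdρ x hx (ContinuousLinearMap.ext fun v ↦ ?_)
    refine (mfderiv_apply_eq_fderiv hxc hhdd v).trans ?_
    rw [← hw, map_zero]
    rfl
  have hgw : 0 < g y₀ w w := chartMetric_pos hy₀V hw0
  set a := Real.sqrt (g y₀ w w) with ha
  have hapos : 0 < a := Real.sqrt_pos.mpr hgw
  have hasq : a ^ 2 = g y₀ w w := Real.sq_sqrt hgw.le
  set S : X → ℝ := fun z ↦ -a⁻¹ * ρ z with hS
  set s : E → ℝ := fun y ↦ -a⁻¹ * h y with hs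
  set n : E := -a⁻¹ • w with hn
  have hsd : ContDiffAt ℝ 2 s y₀ := contDiffAt_const.mul hhd
  have hsfd : ∀ u, fderiv ℝ s y₀ u = -a⁻¹ * fderiv ℝ h y₀ u := fun u ↦ by
    rw [hs, fderiv_const_mul hhdd]
    rfl
  have hsn : ∀ u, fderiv ℝ s y₀ u = g y₀ n u := fun u ↦ by
    rw [hsfd, ← hw, hn]
    simp
  have hnn : g y₀ n n = 1 := by
    have : g y₀ n n = a⁻¹ ^ 2 * g y₀ w w := by rw [hn]; simp; ring
    rw [this, ← hasq]
    field_simp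
  have hcs : ∀ u, (fderiv ℝ s y₀ u) ^ 2 ≤ g y₀ u u := fun u ↦ by
    have h1 : g y₀ n u * g y₀ n u ≤ g y₀ n n * g y₀ u u :=
      real_inner_mul_inner_self_le (mfderiv 𝓘(ℝ, E) 𝓘(ℝ, E) ψ.symm y₀ n)
        (mfderiv 𝓘(ℝ, E) 𝓘(ℝ, E) ψ.symm y₀ u)
    rw [hnn, one_mul] at h1
    rw [hsn u, pow_two]
    exact h1
  set e₀ : Fin p → E := fun i ↦ mfderiv 𝓘(ℝ, E) 𝓘(ℝ, E) ψ x (e i) with he₀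
  have hα : ContDiffOn ℝ 1 (chartForm φ c) ψ.target := (hφ.smooth c).of_le (by norm_cast)
  obtain ⟨ε, hε0, hεLip, hεpar⟩ := exists_parallel_frame hV hgV
    (fun y _ u v ↦ chartMetric_symm c y u v) hginv hα (hpar c) hy₀V e₀
  have he₀g : ∀ i j, g y₀ (e₀ i) (e₀ j) = if i = j then 1 else 0 := fun i j ↦
    (chartMetric_extChartAt hxc (e i) (e j)).trans (orthonormal_iff_ite.mp he.1 i j)
  have he₀φ : chartForm φ c y₀ e₀ = 1 := (chartForm_extChartAt φ hxc e).trans he.2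
  set F : E → ℝ := (fun z ↦ -Real.log (boundaryDist Ω z)) ∘ ψ.symm with hF
  have hΩs : ∀ᶠ y in 𝓝 y₀, 0 < s y → ψ.symm y ∈ Ω := by
    filter_upwards [hpull (hN.eventually_mem hxN)] with y hy hsy
    rw [hΩρ]
    refine ⟨hy, ?_⟩
    have : 0 < a⁻¹ := by positivity
    simp only [hs, hh, Function.comp_apply] at hsy
    nlinarith
  have hfd : ∀ᶠ y in 𝓝 y₀, DifferentiableAt ℝ s y :=
    (hsd.eventually (by simp)).mono fun y hy ↦ hy.differentiableAt (by simp)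
  have hpushV : ∀ {P : E → Prop}, (∀ᶠ y in 𝓝 y₀, P y) → ∀ᶠ z in 𝓝 x, P (ψ z) := fun hP ↦
    (continuousAt_extChartAt' hxc).tendsto.eventually hP
  -- Because |ds| ≤ 1 at `y₀`, continuity makes s locally Lipschitz with constant e^η, which becomes
  -- an additive error η after taking logarithms.
  have hdist : ∀ η > 0, ∀ᶠ y in 𝓝 y₀, |s y| ≤ Real.exp η * boundaryDist Ω (ψ.symm y) := by
    intro η hη
    have hSN : ContMDiffOn 𝓘(ℝ, E) 𝓘(ℝ, ℝ) ∞ S N := contMDiffOn_const.mul hρN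
    refine hpull (P := fun z ↦ |S z| ≤ Real.exp η * boundaryDist Ω z)
      (eventually_abs_le_mul_boundaryDist (Real.exp_pos η) hx
      (fun z hz ↦ by simp [hS, hρ0 z hz]) (hSN.contMDiffAt (hN.mem_nhds hxN)).continuousAt
      (exists_nhds_ofReal_abs_sub_le (E := E) ?_))
    have h1 := eventually_sq_fderiv_le hgc
      (hsd.fderiv_right (m := 1) (by norm_num)).continuousAt hb hbg hcs
      (show 1 < Real.exp η ^ 2 from one_lt_pow₀ (Real.one_lt_exp_iff.mpr hη) two_ne_zero)
    filter_upwards [hN.eventually_mem hxN, hpushV h1, hpushV hfd,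
      (isOpen_extChartAt_source c).eventually_mem hxc] with z hz1 hz2 hz3 hz4
    refine ⟨(hSN.contMDiffAt (hN.mem_nhds hz1)).of_le (by norm_cast), fun v ↦ ?_⟩
    have h2 : mfderiv 𝓘(ℝ, E) 𝓘(ℝ, ℝ) S z v =
      fderiv ℝ s (ψ z) (mfderiv 𝓘(ℝ, E) 𝓘(ℝ, E) ψ z v) := mfderiv_apply_eq_fderiv (f := S) hz4 hz3 v
    refine (congrArg (abs (α := ℝ)) h2).trans_le (abs_le_of_sq_le_sq ?_ (by positivity))
    refine (hz2 _).trans_eq ?_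
    rw [mul_pow]
    congr 1
    exact (chartMetric_extChartAt hz4 v v).trans (real_inner_self_eq_norm_sq v)
  refine false_of_trace_hessianOf_pos (n := n) (F := F) (ε := ε) g hsd ?_ ?_ hΓ (g y₀) hb hbg ?_
    ?_ ?_ ?_ ?_ ?_
  · simp [hs, hh, hsx, hρ0 x hx]
  · rw [hsn, hnn]
  · rwa [hε0]
  · intro i
    have h1 := htan i
    have h2 := (mfderiv_apply_eq_fderiv hxc hhdd (e i)).symm.trans h1
    rw [hε0, hsfd]
    exact mul_eq_zero_of_right _ h2
  · rw [hε0]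
    have h1 := phiHessian_eq_sum hφ c ρ he
    have h2 : ∑ i, hessianOf g s y₀ (e₀ i) (e₀ i) = -a⁻¹ * phiHessian φ c ρ x e := by
      rw [h1, Finset.mul_sum]
      exact Finset.sum_congr rfl fun i _ ↦ hessianOf_const_mul g hhd _ _ _
    rw [h2]
    have : 0 < a⁻¹ := by positivity
    nlinarith
  · filter_upwards [hεpar, hΩs, hV.eventually_mem hy₀V, hpull (hU.eventually_mem (hUfr hx))]
      with y h1 h2 h3 h4 hsy
    have hyU : ψ.symm y ∈ U ∩ Ω := ⟨h4, h2 hsy⟩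
    refine ⟨contDiffAt_comp_symm (hU.inter hΩ) hfs h3 hyU, ?_⟩
    have h5 : ∀ i j, chartMetric c y (ε y i) (ε y j) = if i = j then 1 else 0 := fun i j ↦
      (h1.1 i j).trans (he₀g i j)
    have h6 : chartForm φ c y (ε y) = 1 := h1.2.trans he₀φ
    have h7 := hpos _ hyU c (ψ.map_target h3) _ (isPhiPlane_mfderiv_symm h5 h6)
    rwa [phiHessian_symm_eq_sum hφ h3 _ h5 h6] at h7
  · intro η hη
    filter_upwards [hdist η hη] with y hy hsy
    rw [abs_of_pos hsy] at hy
    have hδ : 0 < boundaryDist Ω (ψ.symm y) :=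
      pos_of_mul_pos_right (hsy.trans_le hy) (Real.exp_pos η).le
    have := Real.log_le_log hsy hy
    rw [Real.log_mul (Real.exp_ne_zero η) hδ.ne', Real.log_exp] at this
    simp only [hF, Function.comp_apply]
    linarith
  -- The distance to ∂Ω is at most the distance to x, hence at most the length of the segment from
  -- `y₀` in direction n; as |n| = 1 at `y₀`, this length is at most e^η t for small t.
  · intro η hη
    have h1 : ∀ᶠ y in 𝓝 y₀, g y n n < Real.exp η ^ 2 := by
      have hc : ContinuousAt (fun y ↦ g y n n) y₀ :=
        (hgc.clm_apply continuousAt_const).clm_apply continuousAt_const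
      refine hc.eventually (gt_mem_nhds ?_)
      change g y₀ n n < _
      rw [hnn]
      exact one_lt_pow₀ (Real.one_lt_exp_iff.mpr hη) two_ne_zero
    have hl : ContinuousAt (fun t : ℝ ↦ y₀ + t • n) 0 := by fun_prop
    have hl' : ∀ {P : E → Prop}, (∀ᶠ y in 𝓝 y₀, P y) → ∀ᶠ t in 𝓝 (0 : ℝ), P (y₀ + t • n) :=
      fun hP ↦ hl.tendsto.eventually (by simpa using hP)
    obtain ⟨r, hr, hball⟩ := Metric.nhds_basis_ball.eventually_iff.mp
      ((hl' h1).and (hl' (hV.eventually_mem hy₀V)))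
    filter_upwards [eventually_mem_nhdsWithin, nhdsWithin_le_nhds (hl' (hdist η hη)),
      nhdsWithin_le_nhds (Metric.ball_mem_nhds (0 : ℝ) hr)] with t ht h2 h3 hst
    replace ht : 0 < t := ht
    have hball' : ∀ τ ∈ Icc 0 t, τ ∈ Metric.ball (0 : ℝ) r := fun τ hτ ↦ by
      rw [Metric.mem_ball, dist_zero_right, Real.norm_eq_abs] at h3 ⊢
      rw [abs_of_nonneg hτ.1]
      exact hτ.2.trans_lt ((le_abs_self t).trans_lt h3)
    rw [abs_of_pos hst] at h2
    have hδ : 0 < boundaryDist Ω (ψ.symm (y₀ + t • n)) :=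
      pos_of_mul_pos_right (hst.trans_le h2) (Real.exp_pos η).le
    have h4 := edist_symm_add_smul_le (c := c) (y := y₀) (n := n) ht.le
      (fun τ hτ ↦ (hball (hball' τ hτ)).2) (fun τ hτ ↦ (hball (hball' τ hτ)).1.le)
      (Real.exp_pos η).le
    rw [← hψ, hsx, edist_comm] at h4
    have h5 : boundaryDist Ω (ψ.symm (y₀ + t • n)) ≤ Real.exp η * t := by
      have h6 := (Metric.infEDist_le_edist_of_mem hx).trans h4
      have h7 := ENNReal.toReal_mono ENNReal.ofReal_ne_top h6
      rwa [ENNReal.toReal_ofReal (by positivity)] at h7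
    have h8 := Real.log_le_log hδ h5
    rw [Real.log_mul (Real.exp_ne_zero η) ht.ne', Real.log_exp] at h8
    simp only [hF, Function.comp_apply]
    linarith

end CalibratedGeometry

theorem proposition4p8
    {E : Type*} [NormedAddCommGroup E] [NormedSpace ℝ E] [FiniteDimensional ℝ E]
    {X : Type*} [EMetricSpace X] [ChartedSpace E X] [IsManifold 𝓘(ℝ, E) ∞ X]
    [RiemannianBundle (fun x : X ↦ TangentSpace 𝓘(ℝ, E) x)]
    [IsContMDiffRiemannianBundle 𝓘(ℝ, E) ∞ E (fun x : X ↦ TangentSpace 𝓘(ℝ, E) x)]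
    [IsRiemannianManifold 𝓘(ℝ, E) X]
    {p : ℕ} (φ : ∀ x : X, TangentSpace 𝓘(ℝ, E) x [⋀^Fin p]→L[ℝ] ℝ)
    (hφ : CalibratedGeometry.IsCalibration φ) (hpar : CalibratedGeometry.IsParallel φ)
    (Ω : Set X) (hΩ : IsOpen Ω) (hcpt : IsCompact (closure Ω))
    (hsmooth : CalibratedGeometry.HasSmoothBoundary E Ω)
    (hpsh : ∃ U : Set X, IsOpen U ∧ frontier Ω ⊆ U ∧
      CalibratedGeometry.IsStrictlyPhiPSHOn φ
        (fun x ↦ -Real.log (CalibratedGeometry.boundaryDist Ω x)) (U ∩ Ω)) :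
    CalibratedGeometry.HasPhiConvexBoundary φ Ω :=
  CalibratedGeometry.hasPhiConvexBoundary_of_isStrictlyPhiPSHOn hφ hpar hΩ hsmooth hpsh
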